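/- **Theorem.** Write $\overline\Pi_T=[0,1]\times[T,\infty)$ and let $0\le m\le n$ be integers. Let $a_j,b_{jk},f_j$ ($1\le j,k\le n$) be real-valued $C^\infty$ functions on $\overline\Pi_0$, let $h_j$ be real-valued $C^\infty$ functions on $[0,\infty)$, and let $\varphi_j$ be real-valued continuous functions on $[0,1]$. Put $a=\operatorname{diag}(a_1,\dots,a_n)$, $b=(b_{jk})$, $f=(f_1,\dots,f_n)$ and consider, for $u=(u_1,\dots,u_n)$, the problem $$(\partial_t+a\,\partial_x+b)u=f\ \text{ in }(0,1)\times(0,\infty),\qquad u(x,0)=\varphi(x),$$ $$u_j(0,t)=h_j(t)\ (1\le j\le m),\qquad u_j(1,t)=h_j(t)\ (m<j\le n).$$ Assume that on $\overline\Pi_0$ 1. $a_j>0$ for all $j\le m$ and $a_j<0$ for all $j>m$; 2. $\inf_{\overline\Pi_0}|a_j|>0$ for all $j\le n$; 3. for all $j\ne k$ there is $p_{jk}\in C^1(\overline\Pi_0)$ such that $b_{jk}=p_{jk}(a_k-a_j)$ and $p_{jk}=0$ in the interior of the set $\{(x,t)\in\overline\Pi_0: a_j(x,t)=a_k(x,t)\}$.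 For $(x,t)\in\overline\Pi_0$ let $\xi\mapsto\omega_j(\xi)=\omega_j(\xi;x,t)$ be the $j$-th characteristic through $(x,t)$, i.e. the solution of $\omega_j'(\xi)=1/a_j(\xi,\omega_j(\xi))$, $\omega_j(x)=t$, followed backwards in time inside $\overline\Pi_0$ until it meets the boundary of $\overline\Pi_0$, on the side $x=0$ (if $j\le m$), on the side $x=1$ (if $j>m$), or on the bottom $t=0$; let $x_j=x_j(x,t)$ be the abscissa of that boundary point. Put $$c_j(\xi,x,t)=\exp\int_x^\xi\Big(\frac{b_{jj}}{a_j}\Big)(\eta,\omega_j(\eta))\,d\eta,\qquad d_j(\xi,x,t)=\frac{c_j(\xi,x,t)}{a_j(\xi,\omega_j(\xi))}.$$ A *continuous solution* of the problem is a continuous function $u:\overline\Pi_0\to\mathbb R^n$ such that for all $j\le n$ and all $(x,t)\in\overline\Pi_0$ $$u_j(x,t)=c_j(x_j,x,t)\,s_j-\int_{x_j}^x d_j(\xi,x,t)\sum_{k\ne j}(b_{jk}u_k)(\xi,\omega_j(\xi))\,d\xi+\int_{x_j}^x d_j(\xi,x,t)f_j(\xi,\omega_j(\xi))\,d\xi,$$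 where $s_j=h_j(\omega_j(x_j))$ if $\omega_j(x_j)>0$ and $s_j=\varphi_j(x_j)$ if $\omega_j(x_j)=0$. Then every continuous solution $u$ is smoothing: for every $k\in\mathbb N$ there exists $T>0$ such that $u_j\in C^k(\overline\Pi_T)$ for all $j\le n$. -/

import Mathlib

open Set MeasureTheory

noncomputable section

namespace HypSmoothing

/-- The closed semi-strip `[0,1] × [T,∞)`, whose points are written `(x, t)`. -/
def closedStrip (T : ℝ) : Set (ℝ × ℝ) := Icc (0 : ℝ) 1 ×ˢ Ici T

/-- The part of the characteristic of `∂_t + a ∂_x` through `(x, t)` that runs backwards in time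
inside `[0,1] × [0,∞)`, written as a graph `ξ ↦ (ξ, ω ξ)` over the segment between `y` and `x`:
it solves `ω' = 1 / a(ξ, ω)`, `ω x = t`, and `y` is the abscissa of the point with the smaller
ordinate at which it meets the boundary of the semi-strip. That point lies on the lateral side
`{inflow} × [0,∞)` or on the bottom `[0,1] × {0}`.
(`inflow` is `0` if `a > 0` and `1` if `a < 0`.) For locally Lipschitz `1 / a` the abscissa `y`
and the values of `ω` between `y` and `x` are determined by `(x, t)`. -/
structure IsBackwardCharacteristic (a : ℝ × ℝ → ℝ) (inflow x t y : ℝ) (ω : ℝ → ℝ) : Prop where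
  abscissa_mem : y ∈ Icc (0 : ℝ) 1
  nonneg : ∀ ξ ∈ uIcc y x, 0 ≤ ω ξ
  ode : ∀ ξ ∈ uIcc y x, HasDerivWithinAt ω (1 / a (ξ, ω ξ)) (uIcc y x) ξ
  initial : ω x = t
  ordinate_le : ω y ≤ t
  boundary : y = inflow ∨ ω y = 0

variable {n : ℕ}

/-- The side `x = 0` carries the boundary condition of the first `m` components, the side
`x = 1` that of the remaining ones. -/
def inflowSide (m : ℕ) (j : Fin n) : ℝ := if (j : ℕ) < m then 0 else 1

/-- `c_j(ξ, x, t) = exp ∫_x^ξ (b_jj / a_j)(η, ω(η)) dη`, where `ω` is the `j`-th characteristic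
through `(x, t)`. -/
def cFun (a : Fin n → ℝ × ℝ → ℝ) (b : Fin n → Fin n → ℝ × ℝ → ℝ) (j : Fin n)
    (ω : ℝ → ℝ) (x ξ : ℝ) : ℝ :=
  Real.exp (∫ η in x..ξ, b j j (η, ω η) / a j (η, ω η))

/-- `d_j(ξ, x, t) = c_j(ξ, x, t) / a_j(ξ, ω(ξ))`. -/
def dFun (a : Fin n → ℝ × ℝ → ℝ) (b : Fin n → Fin n → ℝ × ℝ → ℝ) (j : Fin n)
    (ω : ℝ → ℝ) (x ξ : ℝ) : ℝ :=
  cFun a b j ω x ξ / a j (ξ, ω ξ)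

/-- The data `S` on the parabolic boundary of the semi-strip: `h_j(t)` on the lateral sides if
`t > 0`, and `φ_j(x)` if `t = 0`. -/
def boundaryData (h φ : Fin n → ℝ → ℝ) (j : Fin n) (z : ℝ × ℝ) : ℝ :=
  if 0 < z.2 then h j z.2 else φ j z.1

/-- `u` is a continuous solution on `[0,1] × [0,∞)` of `(∂_t + a ∂_x + b) u = f`, `u(·,0) = φ`,
`u_j(0,·) = h_j` for the first `m` components and `u_j(1,·) = h_j` for the others: `u` is
continuous and satisfies the system of integral equations obtained by integration along
characteristics. -/
def IsContinuousSolution (m : ℕ) (a : Fin n → ℝ × ℝ → ℝ) (b : Fin n → Fin n → ℝ × ℝ → ℝ)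
    (f : Fin n → ℝ × ℝ → ℝ) (h φ : Fin n → ℝ → ℝ) (u : Fin n → ℝ × ℝ → ℝ) : Prop :=
  (∀ j, ContinuousOn (u j) (closedStrip 0)) ∧
  ∀ j, ∀ x ∈ Icc (0 : ℝ) 1, ∀ t ∈ Ici (0 : ℝ), ∃ (y : ℝ) (ω : ℝ → ℝ),
    IsBackwardCharacteristic (a j) (inflowSide m j) x t y ω ∧
    u j (x, t) =
      cFun a b j ω x y * boundaryData h φ j (y, ω y)
      - (∫ ξ in y..x, dFun a b j ω x ξ *
          ∑ k ∈ Finset.univ.filter (fun k => k ≠ j), b j k (ξ, ω ξ) * u k (ξ, ω ξ))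
      + ∫ ξ in y..x, dFun a b j ω x ξ * f j (ξ, ω ξ)

/-- The Levy-type condition: for `j ≠ k` there is a `C¹` function `p` on the closed semi-strip
with `b_jk = p (a_k - a_j)` that vanishes in the interior of `{a_j = a_k}`. -/
def LevyCondition (a : Fin n → ℝ × ℝ → ℝ) (b : Fin n → Fin n → ℝ × ℝ → ℝ) : Prop :=
  ∀ j k : Fin n, j ≠ k → ∃ p : ℝ × ℝ → ℝ,
    ContDiffOn ℝ 1 p (closedStrip 0) ∧
    (∀ z ∈ closedStrip 0, b j k z = p z * (a k z - a j z)) ∧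
    ∀ z ∈ interior {z | z ∈ closedStrip 0 ∧ a j z = a k z}, p z = 0

/-- `u` is smoothing: for every `k` it is `C^k` on `[0,1] × [T,∞)` for some `T > 0`. -/
def IsSmoothing (u : Fin n → ℝ × ℝ → ℝ) : Prop :=
  ∀ k : ℕ, ∃ T : ℝ, 0 < T ∧ ∀ j, ContDiffOn ℝ k (u j) (closedStrip T)

end HypSmoothing

end

open scoped ContDiff

/-!
Regularity after a finite time for a linear first-order hyperbolic system on a strip.

Since `|a_j|` is bounded below, every characteristic crosses the strip in bounded time, so for large
`t` a backward characteristic ends on the inflow side, where the boundary data are smooth, and the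
initial data are no longer felt. Dividing by `a_j` and using `x` as the evolution variable, the system
becomes `(∂ₓ + g_j ∂ₜ) u_j + ∑ₖ B_jk u_k = F_j` with `g_j = 1 / a_j`, and the Levy-type condition
becomes `B_jk = q_jk (g_j - g_k)` with `q_jk = p_jk a_k` of class `C¹`. A continuous solution is
differentiable along its own characteristics only.

The smoothing effect is `exists_hasDerivAt_integral_transversal`. Integrate
`B_jk u_k = q_jk u_k (g_j - g_k)` along a `j`-characteristic. In coordinates `(η, σ)` in which the
`k`-characteristics are the lines `σ = const`, the factor `(g_j - g_k) dη` is a multiple of `dσ`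
along the `j`-characteristic. With a primitive of `q_jk u_k` in `σ` the integral turns into boundary
terms and an integral of the derivative of `q_jk u_k` along `k`-characteristics, and both are `C¹`
functions of the starting point although `u_k` is not. No division by `g_j - g_k` takes place, so
the set where two speeds coincide plays no role. After an integrating factor has removed the diagonal
term, this gives a continuous time derivative `v_j = ∂ₜ u_j` for large times (`exists_hasTimeDeriv`).

The time derivative solves a system of the same form: the off-diagonal coefficients, hence the
Levy-type condition with `q_jk` merely `C¹`, are unchanged, the diagonal ones change by `∂ₜ g_j`, and
`u` enters the right-hand side undifferentiated (`IsCharSolution.exists_timeDeriv`). As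
`∂ₓ u_j = F_j - ∑ₖ B_jk u_k - g_j v_j`, induction on `k` gives the claim
(`IsCharSolution.exists_contDiffOn`).

All characteristics are orbits of the flow of a scalar equation with a right-hand side defined on the
whole plane. Its differentiability in the initial point is elementary in the scalar case, because
the difference of two solutions solves a linear equation.
-/

namespace HypSmoothing

/-! ### Calculus lemmas -/

theorem continuous_integral_of_continuous {X : Type*} [TopologicalSpace X]
    [FirstCountableTopology X] {f : X → ℝ → ℝ} (hf : Continuous fun p : X × ℝ => f p.1 p.2)
    {r s : X → ℝ} (hr : Continuous r) (hs : Continuous s) :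
    Continuous fun x => ∫ t in r x..s x, f x t := by
  have hf' : Continuous f.uncurry := hf
  have hi : ∀ x a b, IntervalIntegrable (f x) volume a b := fun x a b =>
    (show Continuous (f x) from hf.comp (by fun_prop : Continuous fun t => (x, t))).intervalIntegrable
      _ _
  have : (fun x => ∫ t in r x..s x, f x t)
      = fun x => (∫ t in (0 : ℝ)..s x, f x t) - ∫ t in (0 : ℝ)..r x, f x t := by
    funext x
    rw [intervalIntegral.integral_interval_sub_left (hi _ _ _) (hi _ _ _)]
  rw [this]
  fun_prop

/-- Differentiation under the integral sign for a continuous integrand whose parameter derivative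
extends to a continuous function. -/
theorem hasDerivAt_integral_param {H Hs : ℝ × ℝ → ℝ} (hH : Continuous H) (hHs : Continuous Hs)
    {S : Set ℝ} (hS : IsOpen S) {a b : ℝ}
    (hd : ∀ η ∈ uIcc a b, ∀ s ∈ S, HasDerivAt (fun s => H (η, s)) (Hs (η, s)) s)
    {s : ℝ} (hs : s ∈ S) :
    HasDerivAt (fun s => ∫ η in a..b, H (η, s)) (∫ η in a..b, Hs (η, s)) s := by
  obtain ⟨ε, hε, hball⟩ := Metric.isOpen_iff.1 hS s hs
  have hK : IsCompact (uIcc a b ×ˢ Metric.closedBall s 1) :=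
    isCompact_uIcc.prod (isCompact_closedBall s 1)
  obtain ⟨C, hC⟩ := hK.exists_bound_of_continuousOn hHs.continuousOn
  have hn : Metric.ball s (min ε 1) ∈ nhds s := Metric.ball_mem_nhds _ (by positivity)
  refine (intervalIntegral.hasDerivAt_integral_of_dominated_loc_of_deriv_le
    (F := fun s η => H (η, s)) (F' := fun s η => Hs (η, s)) (bound := fun _ => C) hn ?_ ?_ ?_
    ?_ ?_ ?_).2
  · exact Filter.Eventually.of_forall fun x =>
      (by fun_prop : Continuous fun η => H (η, x)).aestronglyMeasurable
  · exact (by fun_prop : Continuous fun η => H (η, s)).intervalIntegrable _ _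
  · exact (by fun_prop : Continuous fun η => Hs (η, s)).aestronglyMeasurable
  · refine Filter.Eventually.of_forall fun η hη x hx => hC (η, x) ⟨uIoc_subset_uIcc hη, ?_⟩
    exact Metric.ball_subset_closedBall (Metric.ball_subset_ball (min_le_right _ _) hx)
  · exact intervalIntegrable_const
  · refine Filter.Eventually.of_forall fun η hη x hx => hd η (uIoc_subset_uIcc hη) x ?_
    exact hball (Metric.ball_subset_ball (min_le_left _ _) hx)

/-- A function of two real variables with continuous partial derivatives is differentiable. -/
theorem hasFDerivAt_of_partial {F Fx Ft : ℝ × ℝ → ℝ} {z : ℝ × ℝ}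
    (hx : ∀ᶠ w in nhds z, HasDerivAt (fun x => F (x, w.2)) (Fx w) w.1)
    (ht : ∀ᶠ w in nhds z, HasDerivAt (fun t => F (w.1, t)) (Ft w) w.2)
    (cx : ContinuousAt Fx z) (ct : ContinuousAt Ft z) :
    HasFDerivAt F (Fx z • ContinuousLinearMap.fst ℝ ℝ ℝ + Ft z • ContinuousLinearMap.snd ℝ ℝ ℝ)
      z := by
  have key := hasStrictFDerivAt_uncurry_coprod (𝕜 := ℝ) (f := fun x t => F (x, t)) (u := z)
    (f₁ := fun x t => ContinuousLinearMap.toSpanSingleton ℝ (Fx (x, t)))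
    (f₂ := fun x t => ContinuousLinearMap.toSpanSingleton ℝ (Ft (x, t)))
    (by filter_upwards [hx] with w hw using hw.hasFDerivAt)
    (by filter_upwards [ht] with w hw using hw.hasFDerivAt)
    ?_ ?_
  · refine HasFDerivAt.congr_fderiv (f := F) key.hasFDerivAt ?_
    ext <;> simp [Function.HasUncurry.uncurry]
  · exact (ContinuousLinearMap.toSpanSingletonCLE (𝕜 := ℝ) (E := ℝ)).continuous.continuousAt.comp cx
  · exact (ContinuousLinearMap.toSpanSingletonCLE (𝕜 := ℝ) (E := ℝ)).continuous.continuousAt.comp ct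

/-- The chain rule along a curve for a function differentiable in the plane. -/
theorem hasDerivAt_comp_curve {F : ℝ × ℝ → ℝ} {p q : ℝ} {γ₁ γ₂ : ℝ → ℝ} {s c₁ c₂ : ℝ}
    (hF : HasFDerivAt F (p • ContinuousLinearMap.fst ℝ ℝ ℝ + q • ContinuousLinearMap.snd ℝ ℝ ℝ)
      (γ₁ s, γ₂ s)) (h₁ : HasDerivAt γ₁ c₁ s) (h₂ : HasDerivAt γ₂ c₂ s) :
    HasDerivAt (fun r => F (γ₁ r, γ₂ r)) (p * c₁ + q * c₂) s := by
  refine HasDerivAt.congr_deriv (hF.comp_hasDerivAt s (h₁.prodMk h₂)) ?_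
  simp

/-- The scalar linear equation `δ' = Γ δ` on an interval. -/
theorem eq_mul_exp_of_hasDerivAt {δ Γ : ℝ → ℝ} {a b : ℝ} (hδ : ContinuousOn δ (uIcc a b))
    (hΓ : Continuous Γ)
    (hd : ∀ ξ ∈ Ioo (min a b) (max a b), HasDerivAt δ (Γ ξ * δ ξ) ξ) :
    δ b = δ a * Real.exp (∫ ξ in a..b, Γ ξ) := by
  have hP : ∀ ξ, HasDerivAt (fun ξ => ∫ η in a..ξ, Γ η) (Γ ξ) ξ := fun ξ =>
    intervalIntegral.integral_hasDerivAt_right (hΓ.intervalIntegrable _ _)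
      (hΓ.stronglyMeasurableAtFilter _ _) hΓ.continuousAt
  have hc : Continuous fun ξ => ∫ η in a..ξ, Γ η :=
    continuous_iff_continuousAt.2 fun ξ => (hP ξ).continuousAt
  have h0 := intervalIntegral.integral_eq_sub_of_hasDeriv_right (a := a) (b := b)
    (f := fun ξ => δ ξ * Real.exp (-∫ η in a..ξ, Γ η)) (f' := fun _ => 0)
    (hδ.mul (by fun_prop : Continuous fun ξ => Real.exp (-∫ η in a..ξ, Γ η)).continuousOn)
    (fun ξ hξ => by
      refine HasDerivAt.hasDerivWithinAt (HasDerivAt.congr_deriv ((hd ξ hξ).mul (hP ξ).neg.exp) ?_)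
      simp only [Pi.neg_apply]
      ring) intervalIntegrable_const
  simp only [intervalIntegral.integral_zero, intervalIntegral.integral_same, neg_zero,
    Real.exp_zero, mul_one, Real.exp_neg] at h0
  have hE := Real.exp_pos (∫ ξ in a..b, Γ ξ)
  field_simp at h0
  linarith

/-- Carathéodory's criterion for differentiability. -/
theorem hasDerivAt_of_sub_eq_mul {f E : ℝ → ℝ} {x : ℝ} (h : ∀ y, f y - f x = (y - x) * E y)
    (hE : ContinuousAt E x) : HasDerivAt f (E x) x := by
  rw [hasDerivAt_iff_tendsto_slope]
  refine (hE.tendsto.mono_left nhdsWithin_le_nhds).congr' ?_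
  filter_upwards [self_mem_nhdsWithin] with y hy
  have : y - x ≠ 0 := sub_ne_zero.2 hy
  rw [slope_def_field, h y]
  field_simp

end HypSmoothing

namespace HypSmoothing

/-! ### The flow of a scalar equation `w' = g(ξ, w)` -/

/-- A right-hand side of the scalar equation `w'(ξ) = g(ξ, w(ξ))` on the whole plane: continuous,
bounded by `M`, and with a continuous derivative `dg` in the unknown. -/
structure SpeedField where
  g : ℝ × ℝ → ℝ
  dg : ℝ × ℝ → ℝ
  M : ℝ
  continuous_g : Continuous g
  continuous_dg : Continuous dg
  hasDerivAt_g : ∀ x t, HasDerivAt (fun t => g (x, t)) (dg (x, t)) t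
  bound : ∀ z, |g z| ≤ M

noncomputable section

namespace SpeedField

attribute [fun_prop] continuous_g continuous_dg

variable (G : SpeedField)

theorem M_nonneg : 0 ≤ G.M := (abs_nonneg _).trans (G.bound (0, 0))

/-- The divided difference `(g(x, b) - g(x, a)) / (b - a)`, in a form that is continuous also on
the diagonal `a = b`. -/
def divDiff (x a b : ℝ) : ℝ := ∫ r in (0 : ℝ)..1, G.dg (x, a + r * (b - a))

theorem divDiff_mul (x a b : ℝ) : G.divDiff x a b * (b - a) = G.g (x, b) - G.g (x, a) := by
  have h := intervalIntegral.integral_eq_sub_of_hasDerivAt (a := 0) (b := 1)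
    (f := fun r => G.g (x, a + r * (b - a)))
    (f' := fun r => G.dg (x, a + r * (b - a)) * (b - a))
    (fun r _ => by
      have h1 : HasDerivAt (fun r : ℝ => a + r * (b - a)) (b - a) r := by
        simpa using ((hasDerivAt_id r).mul_const (b - a)).const_add a
      exact (G.hasDerivAt_g x (a + r * (b - a))).comp r h1)
    ((by fun_prop : Continuous fun r => G.dg (x, a + r * (b - a)) * (b - a)).intervalIntegrable
      _ _)
  rw [intervalIntegral.integral_mul_const] at h
  rw [divDiff, h]
  simp

theorem divDiff_self (x a : ℝ) : G.divDiff x a a = G.dg (x, a) := by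
  simp [divDiff]

@[fun_prop]
theorem continuous_divDiff {X : Type*} [TopologicalSpace X] [FirstCountableTopology X]
    {x a b : X → ℝ} (hx : Continuous x) (ha : Continuous a) (hb : Continuous b) :
    Continuous fun p => G.divDiff (x p) (a p) (b p) := by
  unfold divDiff
  apply continuous_integral_of_continuous <;> fun_prop

/-- `w` solves the equation between `a` and `b`. -/
def IsSolutionBetween (w : ℝ → ℝ) (a b : ℝ) : Prop :=
  ContinuousOn w (uIcc a b) ∧
    ∀ ξ ∈ Ioo (min a b) (max a b), HasDerivAt w (G.g (ξ, w ξ)) ξ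

variable {G}

theorem IsSolutionBetween.sub_eq {w₁ w₂ : ℝ → ℝ} {a b : ℝ} (h₁ : G.IsSolutionBetween w₁ a b)
    (h₂ : G.IsSolutionBetween w₂ a b) :
    w₂ b - w₁ b
      = (w₂ a - w₁ a) * Real.exp (∫ ξ in a..b, G.divDiff ξ (w₁ ξ) (w₂ ξ)) := by
  set c : ℝ → ℝ := fun ξ => max (min a b) (min (max a b) ξ) with hc
  have hcc : Continuous c := by fun_prop
  have hm : ∀ ξ, c ξ ∈ uIcc a b := fun ξ =>
    ⟨le_max_left _ _, max_le min_le_max (min_le_left _ _)⟩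
  have hid : ∀ ξ ∈ uIcc a b, c ξ = ξ := fun ξ hξ => by
    simp only [hc]; rw [min_eq_right hξ.2, max_eq_right hξ.1]
  have k₁ : Continuous fun ξ => w₁ (c ξ) := h₁.1.comp_continuous hcc hm
  have k₂ : Continuous fun ξ => w₂ (c ξ) := h₂.1.comp_continuous hcc hm
  have key := eq_mul_exp_of_hasDerivAt (δ := fun ξ => w₂ ξ - w₁ ξ)
    (Γ := fun ξ => G.divDiff ξ (w₁ (c ξ)) (w₂ (c ξ))) (h₂.1.sub h₁.1)
    (G.continuous_divDiff continuous_id k₁ k₂)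
    (fun ξ hξ => by
      refine HasDerivAt.congr_deriv ((h₂.2 ξ hξ).sub (h₁.2 ξ hξ)) ?_
      rw [hid ξ (Ioo_subset_Icc_self hξ), G.divDiff_mul])
  rw [key, intervalIntegral.integral_congr (g := fun ξ => G.divDiff ξ (w₁ ξ) (w₂ ξ))]
  intro ξ hξ
  simp only [hid ξ hξ]

theorem IsSolutionBetween.unique {w₁ w₂ : ℝ → ℝ} {a b : ℝ} (h₁ : G.IsSolutionBetween w₁ a b)
    (h₂ : G.IsSolutionBetween w₂ a b) (h : w₁ a = w₂ a) : w₁ b = w₂ b := by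
  have := h₁.sub_eq h₂
  rw [h, sub_self, zero_mul] at this
  linarith

variable (G)

theorem exists_solution_Icc (x t : ℝ) {N : ℝ} (hN : 0 ≤ N) :
    ∃ w : ℝ → ℝ, w x = t ∧ ∀ ξ ∈ Icc (x - N) (x + N),
      HasDerivWithinAt w (G.g (ξ, w ξ)) (Icc (x - N) (x + N)) ξ := by
  have hM := G.M_nonneg
  have hK : IsCompact (Icc (x - N) (x + N) ×ˢ Metric.closedBall t (G.M * N)) :=
    isCompact_Icc.prod (isCompact_closedBall _ _)
  obtain ⟨C, hC⟩ := hK.exists_bound_of_continuousOn G.continuous_dg.continuousOn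
  have hx : x ∈ Icc (x - N) (x + N) := by constructor <;> linarith
  have hC0 : 0 ≤ C := (norm_nonneg _).trans
    (hC (x, t) ⟨hx, Metric.mem_closedBall_self (by positivity)⟩)
  have hPL : IsPicardLindelof (fun ξ s => G.g (ξ, s)) (⟨x, hx⟩ : Icc (x - N) (x + N)) t
      ⟨G.M * N, by positivity⟩ 0 ⟨G.M, hM⟩ ⟨C, hC0⟩ := by
    refine ⟨fun ξ hξ => ?_, fun s _ => ?_, fun ξ _ s _ => G.bound _, ?_⟩
    · refine (convex_closedBall _ _).lipschitzOnWith_of_nnnorm_hasDerivWithin_le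
        (fun s _ => (G.hasDerivAt_g ξ s).hasDerivWithinAt) fun s hs => ?_
      exact hC (ξ, s) ⟨hξ, hs⟩
    · exact (by fun_prop : Continuous fun ξ => G.g (ξ, s)).continuousOn
    · simp only [sub_sub_cancel, add_sub_cancel_left, max_self, NNReal.coe_zero, sub_zero]
      exact le_rfl
  exact hPL.exists_eq_forall_mem_Icc_hasDerivWithinAt₀

/-- Solutions on the whole line: those on the intervals of radius `N` around `x` agree where both
are defined. -/
theorem exists_solution (x t : ℝ) :
    ∃ w : ℝ → ℝ, w x = t ∧ ∀ ξ, HasDerivAt w (G.g (ξ, w ξ)) ξ := by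
  choose W hW0 hW using fun n : ℕ => G.exists_solution_Icc x t (N := (n : ℝ) + 1) (by positivity)
  have hsol : ∀ (n : ℕ) (ξ : ℝ), |ξ - x| < n + 1 → G.IsSolutionBetween (W n) x ξ := by
    intro n ξ hξ
    rw [abs_lt] at hξ
    have hlo : x - (n + 1) < min x ξ := lt_min (by linarith) (by linarith)
    have hhi : max x ξ < x + (n + 1) := max_lt (by linarith) (by linarith)
    refine ⟨fun ζ hζ => ?_, fun ζ hζ => ?_⟩
    · refine ((hW n ζ ⟨hlo.le.trans hζ.1, hζ.2.trans hhi.le⟩).continuousWithinAt).mono ?_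
      exact Icc_subset_Icc hlo.le hhi.le
    · refine (hW n ζ ⟨hlo.le.trans hζ.1.le, hζ.2.le.trans hhi.le⟩).hasDerivAt ?_
      exact Icc_mem_nhds (hlo.trans hζ.1) (hζ.2.trans hhi)
  have hagree : ∀ (n k : ℕ) (ξ : ℝ), |ξ - x| < n + 1 → |ξ - x| < k + 1 → W n ξ = W k ξ :=
    fun n k ξ hn hk => (hsol n ξ hn).unique (hsol k ξ hk) (by rw [hW0, hW0])
  refine ⟨fun ξ => W ⌈|ξ - x|⌉₊ ξ, hW0 _, fun ξ => ?_⟩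
  have hlt : ∀ ζ : ℝ, |ζ - x| < (⌈|ζ - x|⌉₊ : ℝ) + 1 := fun ζ =>
    (Nat.le_ceil _).trans_lt (lt_add_one _)
  set n := ⌈|ξ - x|⌉₊ with hn
  have hev : ∀ᶠ ζ in nhds ξ, |ζ - x| < (n : ℝ) + 1 :=
    (by fun_prop : Continuous fun ζ : ℝ => |ζ - x|).continuousAt.eventually_lt_const (hlt ξ)
  have hd : HasDerivAt (W n) (G.g (ξ, W n ξ)) ξ := by
    have := abs_lt.1 (hlt ξ)
    refine (hW n ξ ⟨by linarith, by linarith⟩).hasDerivAt (Icc_mem_nhds (by linarith) (by linarith))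
  refine hd.congr_of_eventuallyEq ?_
  filter_upwards [hev] with ζ hζ using hagree _ _ _ (hlt ζ) hζ

/-- The flow: `G.flow (ξ, x, t)` is the value at `ξ` of the solution that equals `t` at `x`. -/
def flow (p : ℝ × ℝ × ℝ) : ℝ := (G.exists_solution p.2.1 p.2.2).choose p.1

@[simp]
theorem flow_self (x t : ℝ) : G.flow (x, x, t) = t := (G.exists_solution x t).choose_spec.1

theorem hasDerivAt_flow (ξ x t : ℝ) :
    HasDerivAt (fun ξ => G.flow (ξ, x, t)) (G.g (ξ, G.flow (ξ, x, t))) ξ :=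
  (G.exists_solution x t).choose_spec.2 ξ

theorem isSolutionBetween_flow (x t a b : ℝ) :
    G.IsSolutionBetween (fun ξ => G.flow (ξ, x, t)) a b :=
  ⟨fun ξ _ => (G.hasDerivAt_flow ξ x t).continuousAt.continuousWithinAt,
    fun ξ _ => G.hasDerivAt_flow ξ x t⟩

@[simp]
theorem flow_flow (ζ ξ x t : ℝ) : G.flow (ζ, ξ, G.flow (ξ, x, t)) = G.flow (ζ, x, t) :=
  IsSolutionBetween.unique (w₁ := fun ζ => G.flow (ζ, ξ, G.flow (ξ, x, t)))
    (w₂ := fun ζ => G.flow (ζ, x, t)) (G.isSolutionBetween_flow _ _ ξ ζ)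
    (G.isSolutionBetween_flow x t ξ ζ) (G.flow_self _ _)

theorem abs_flow_sub_flow_le (ξ ζ x t : ℝ) :
    |G.flow (ξ, x, t) - G.flow (ζ, x, t)| ≤ G.M * |ξ - ζ| :=
  convex_univ.norm_image_sub_le_of_norm_hasDerivWithin_le (f := fun ξ => G.flow (ξ, x, t))
    (fun η _ => (G.hasDerivAt_flow η x t).hasDerivWithinAt) (fun _ _ => G.bound _)
    (mem_univ ζ) (mem_univ ξ)

theorem abs_flow_sub_le (ξ x t : ℝ) : |G.flow (ξ, x, t) - t| ≤ G.M * |ξ - x| := by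
  simpa using G.abs_flow_sub_flow_le ξ x x t

/-- The difference of two solutions solves a linear equation; hence uniqueness, continuity and
differentiability of the flow in the initial value. -/
theorem flow_sub_flow (ξ x t₁ t₂ : ℝ) :
    G.flow (ξ, x, t₂) - G.flow (ξ, x, t₁) = (t₂ - t₁) *
      Real.exp (∫ η in x..ξ, G.divDiff η (G.flow (η, x, t₁)) (G.flow (η, x, t₂))) := by
  simpa using (G.isSolutionBetween_flow x t₁ x ξ).sub_eq (G.isSolutionBetween_flow x t₂ x ξ)

theorem continuous_flow_right (ξ x : ℝ) : Continuous fun t => G.flow (ξ, x, t) := by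
  refine continuous_iff_continuousAt.2 fun t => ?_
  set R : ℝ := 1 + G.M * |ξ - x| with hR
  have hRM : 0 ≤ G.M * |ξ - x| := mul_nonneg G.M_nonneg (abs_nonneg _)
  have hK : IsCompact (uIcc x ξ ×ˢ (Metric.closedBall t R ×ˢ Metric.closedBall t R)) :=
    isCompact_uIcc.prod ((isCompact_closedBall _ _).prod (isCompact_closedBall _ _))
  obtain ⟨C, hC⟩ := hK.exists_bound_of_continuousOn
    (f := fun p : ℝ × ℝ × ℝ => G.divDiff p.1 p.2.1 p.2.2)
    (by fun_prop : Continuous fun p : ℝ × ℝ × ℝ => G.divDiff p.1 p.2.1 p.2.2).continuousOn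
  have hstay : ∀ s η, |s - t| ≤ 1 → η ∈ uIcc x ξ → G.flow (η, x, s) ∈ Metric.closedBall t R := by
    intro s η hs hη
    rw [Metric.mem_closedBall, Real.dist_eq]
    have h1 := G.abs_flow_sub_le η x s
    have h2 : |η - x| ≤ |ξ - x| := by
      have := abs_sub_left_of_mem_uIcc hη
      exact this
    have h3 := mul_le_mul_of_nonneg_left h2 G.M_nonneg
    have h4 := abs_sub_le (G.flow (η, x, s)) s t
    linarith
  have hbound : ∀ᶠ s in nhds t,
      |G.flow (ξ, x, s) - G.flow (ξ, x, t)| ≤ |s - t| * Real.exp (C * |ξ - x|) := by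
    have hev : ∀ᶠ s in nhds t, |s - t| < 1 := Metric.ball_mem_nhds t one_pos
    filter_upwards [hev] with s hs
    rw [G.flow_sub_flow, abs_mul, Real.abs_exp]
    gcongr
    refine (le_abs_self _).trans ?_
    refine intervalIntegral.norm_integral_le_of_norm_le_const (C := C)
      (f := fun η => G.divDiff η (G.flow (η, x, t)) (G.flow (η, x, s))) fun η hη => ?_
    have hη' := uIoc_subset_uIcc hη
    exact hC (η, _, _) ⟨hη', hstay t η (by simp) hη', hstay s η hs.le hη'⟩
  rw [ContinuousAt, tendsto_iff_norm_sub_tendsto_zero]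
  refine squeeze_zero' (Filter.Eventually.of_forall fun _ => norm_nonneg _) hbound ?_
  have : Continuous fun s : ℝ => |s - t| * Real.exp (C * |ξ - x|) := by fun_prop
  simpa using this.tendsto t

@[fun_prop]
theorem continuous_flow : Continuous G.flow := by
  refine continuous_iff_continuousAt.2 fun ⟨ξ, x, t⟩ => ?_
  have h1 : Filter.Tendsto (fun p : ℝ × ℝ × ℝ => G.flow (x, p.2.1, p.2.2)) (nhds (ξ, x, t))
      (nhds t) := by
    rw [tendsto_iff_norm_sub_tendsto_zero]
    refine squeeze_zero (g := fun p : ℝ × ℝ × ℝ => G.M * |x - p.2.1| + |p.2.2 - t|)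
      (fun _ => norm_nonneg _) (fun p => ?_) ?_
    · have h1 := G.abs_flow_sub_le x p.2.1 p.2.2
      have h2 := abs_sub_le (G.flow (x, p.2.1, p.2.2)) p.2.2 t
      rw [Real.norm_eq_abs]
      linarith
    · have : Continuous fun p : ℝ × ℝ × ℝ => G.M * |x - p.2.1| + |p.2.2 - t| := by fun_prop
      simpa using this.tendsto (ξ, x, t)
  have h2 : Filter.Tendsto (fun p : ℝ × ℝ × ℝ => G.flow (ξ, p.2.1, p.2.2)) (nhds (ξ, x, t))
      (nhds (G.flow (ξ, x, t))) := by
    have := ((G.continuous_flow_right ξ x).tendsto t).comp h1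
    simp only [Function.comp_def, flow_flow] at this
    exact this
  have h3 : Filter.Tendsto
      (fun p : ℝ × ℝ × ℝ => G.flow p - G.flow (ξ, p.2.1, p.2.2)) (nhds (ξ, x, t)) (nhds 0) := by
    rw [tendsto_zero_iff_norm_tendsto_zero]
    refine squeeze_zero (g := fun p : ℝ × ℝ × ℝ => G.M * |p.1 - ξ|)
      (fun _ => norm_nonneg _) (fun p => G.abs_flow_sub_flow_le _ _ _ _) ?_
    have : Continuous fun p : ℝ × ℝ × ℝ => G.M * |p.1 - ξ| := by fun_prop
    simpa using this.tendsto (ξ, x, t)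
  simpa [ContinuousAt] using h3.add h2

/-- The derivative of the flow in the initial value. -/
def dflow (p : ℝ × ℝ × ℝ) : ℝ :=
  Real.exp (∫ η in p.2.1..p.1, G.dg (η, G.flow (η, p.2.1, p.2.2)))

theorem dflow_pos (p : ℝ × ℝ × ℝ) : 0 < G.dflow p := Real.exp_pos _

@[simp]
theorem dflow_self (x t : ℝ) : G.dflow (x, x, t) = 1 := by simp [dflow]

@[fun_prop]
theorem continuous_dflow : Continuous G.dflow := by
  unfold dflow
  refine Real.continuous_exp.comp ?_
  apply continuous_integral_of_continuous <;> fun_prop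

theorem dflow_mul_dflow (ζ ξ x t : ℝ) :
    G.dflow (ζ, ξ, G.flow (ξ, x, t)) * G.dflow (ξ, x, t) = G.dflow (ζ, x, t) := by
  have hi : ∀ a b, IntervalIntegrable (fun η => G.dg (η, G.flow (η, x, t))) volume a b :=
    fun a b => (by fun_prop : Continuous fun η => G.dg (η, G.flow (η, x, t))).intervalIntegrable _ _
  simp only [dflow, flow_flow]
  rw [← Real.exp_add, add_comm, intervalIntegral.integral_add_adjacent_intervals (hi _ _) (hi _ _)]

theorem hasDerivAt_dflow (ξ x t : ℝ) :
    HasDerivAt (fun ξ => G.dflow (ξ, x, t))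
      (G.dg (ξ, G.flow (ξ, x, t)) * G.dflow (ξ, x, t)) ξ := by
  have hc : Continuous fun η => G.dg (η, G.flow (η, x, t)) := by fun_prop
  have := (intervalIntegral.integral_hasDerivAt_right (hc.intervalIntegrable x ξ)
    (hc.stronglyMeasurableAtFilter _ _) hc.continuousAt).exp
  exact this.congr_deriv (mul_comm _ _)

theorem hasDerivAt_flow_right (ξ x t : ℝ) :
    HasDerivAt (fun t => G.flow (ξ, x, t)) (G.dflow (ξ, x, t)) t := by
  have h := hasDerivAt_of_sub_eq_mul (x := t) (fun s => G.flow_sub_flow ξ x t s) ?_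
  · simpa [divDiff_self, dflow] using h
  · refine Continuous.continuousAt (Real.continuous_exp.comp ?_)
    apply continuous_integral_of_continuous <;> fun_prop

theorem hasDerivAt_flow_base (ξ x t : ℝ) :
    HasDerivAt (fun x => G.flow (ξ, x, t)) (-G.g (x, t) * G.dflow (ξ, x, t)) x := by
  have h0 : HasDerivAt (fun y => G.flow (x, y, t)) (-G.g (x, t)) x := by
    have h := hasDerivAt_of_sub_eq_mul (f := fun y => G.flow (x, y, t)) (x := x)
      (E := fun y => -∫ r in (0 : ℝ)..1, G.g (y + r * (x - y), G.flow (y + r * (x - y), y, t)))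
      (fun y => ?_) ?_
    · simpa using h
    · have h := intervalIntegral.integral_eq_sub_of_hasDerivAt (a := 0) (b := 1)
        (f := fun r => G.flow (y + r * (x - y), y, t))
        (f' := fun r => G.g (y + r * (x - y), G.flow (y + r * (x - y), y, t)) * (x - y))
        (fun r _ => by
          have h1 : HasDerivAt (fun r : ℝ => y + r * (x - y)) (x - y) r := by
            simpa using ((hasDerivAt_id r).mul_const (x - y)).const_add y
          exact (G.hasDerivAt_flow (y + r * (x - y)) y t).comp r h1)
        ((by fun_prop : Continuous fun r =>
          G.g (y + r * (x - y), G.flow (y + r * (x - y), y, t)) * (x - y)).intervalIntegrable _ _)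
      rw [intervalIntegral.integral_mul_const] at h
      simp only [one_mul, zero_mul, add_zero, add_sub_cancel, flow_self] at h ⊢
      linarith
    · refine Continuous.continuousAt (Continuous.neg ?_)
      apply continuous_integral_of_continuous <;> fun_prop
  have h1 : HasDerivAt (fun s => G.flow (ξ, x, s)) (G.dflow (ξ, x, t)) (G.flow (x, x, t)) := by
    rw [flow_self]; exact G.hasDerivAt_flow_right ξ x t
  have := HasDerivAt.comp (h₂ := fun s => G.flow (ξ, x, s)) (h := fun y => G.flow (x, y, t)) x h1 h0
  simp only [Function.comp_def, flow_flow] at this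
  exact this.congr_deriv (mul_comm _ _)

/-- The value at `ξ` of the solution through `(x, t)` is differentiable in `(x, t)`. -/
theorem hasFDerivAt_flow (ξ : ℝ) (z : ℝ × ℝ) :
    HasFDerivAt (fun z : ℝ × ℝ => G.flow (ξ, z.1, z.2))
      ((-G.g z * G.dflow (ξ, z.1, z.2)) • ContinuousLinearMap.fst ℝ ℝ ℝ
        + G.dflow (ξ, z.1, z.2) • ContinuousLinearMap.snd ℝ ℝ ℝ) z :=
  hasFDerivAt_of_partial (Fx := fun z => -G.g z * G.dflow (ξ, z.1, z.2))
    (Ft := fun z => G.dflow (ξ, z.1, z.2))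
    (Filter.Eventually.of_forall fun w => G.hasDerivAt_flow_base ξ w.1 w.2)
    (Filter.Eventually.of_forall fun w => G.hasDerivAt_flow_right ξ w.1 w.2)
    (Continuous.continuousAt (by fun_prop)) (Continuous.continuousAt (by fun_prop))

end SpeedField

end

end HypSmoothing

noncomputable section

namespace HypSmoothing

/-! ### Differentiation along characteristics -/

/-- On `(0,1) × (T,∞)` the derivative of `u` along the characteristics of `G` is `R`. -/
def HasCharDeriv (G : SpeedField) (u R : ℝ × ℝ → ℝ) (T : ℝ) : Prop :=
  ∀ x ∈ Ioo (0 : ℝ) 1, ∀ t, T < t → HasDerivAt (fun ξ => u (ξ, G.flow (ξ, x, t))) (R (x, t)) x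

/-- On `[0,1] × (T,∞)` the derivative of `u` in the second variable is `v`; both functions are
continuous on the whole plane. -/
structure HasTimeDeriv (u v : ℝ × ℝ → ℝ) (T : ℝ) : Prop where
  continuous_fun : Continuous u
  continuous_deriv : Continuous v
  hasDerivAt : ∀ x ∈ Icc (0 : ℝ) 1, ∀ t, T < t → HasDerivAt (fun t => u (x, t)) (v (x, t)) t

section

variable {G K : SpeedField} {u R : ℝ × ℝ → ℝ} {T M : ℝ}

theorem HasCharDeriv.mono (h : HasCharDeriv G u R T) {T' : ℝ} (hT : T ≤ T') :
    HasCharDeriv G u R T' := fun x hx t ht => h x hx t (hT.trans_lt ht)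

theorem HasTimeDeriv.mono {v : ℝ × ℝ → ℝ} (h : HasTimeDeriv u v T) {T' : ℝ} (hT : T ≤ T') :
    HasTimeDeriv u v T' :=
  ⟨h.continuous_fun, h.continuous_deriv, fun x hx t ht => h.hasDerivAt x hx t (hT.trans_lt ht)⟩

theorem HasCharDeriv.mul {w S : ℝ × ℝ → ℝ} (hu : HasCharDeriv G u R T)
    (hw : HasCharDeriv G w S T) :
    HasCharDeriv G (fun z => u z * w z) (fun z => R z * w z + u z * S z) T := by
  intro x hx t ht
  refine HasDerivAt.congr_deriv ((hu x hx t ht).mul (hw x hx t ht)) ?_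
  simp

/-- The derivative along a given characteristic, at an arbitrary point of it. -/
theorem HasCharDeriv.hasDerivAt_flow (h : HasCharDeriv G u R T) {ξ x t : ℝ} (hξ : ξ ∈ Ioo (0 : ℝ) 1)
    (ht : T < G.flow (ξ, x, t)) :
    HasDerivAt (fun ξ => u (ξ, G.flow (ξ, x, t))) (R (ξ, G.flow (ξ, x, t))) ξ := by
  simpa using h ξ hξ _ ht

/-- Over the unit interval a solution moves by at most `M`. This is why each passage to another
point of a characteristic costs one `M` in the time after which a statement holds. -/
theorem SpeedField.lt_flow (hM : G.M ≤ M) {ξ x t : ℝ} (hξ : ξ ∈ Icc (0 : ℝ) 1)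
    (hx : x ∈ Icc (0 : ℝ) 1) (ht : T + M < t) : T < G.flow (ξ, x, t) := by
  have h1 := abs_le.1 (G.abs_flow_sub_le ξ x t)
  have h2 : |ξ - x| ≤ 1 := abs_le.2 ⟨by linarith [hξ.1, hx.2], by linarith [hξ.2, hx.1]⟩
  have h3 : G.M * |ξ - x| ≤ G.M * 1 := mul_le_mul_of_nonneg_left h2 G.M_nonneg
  linarith [h1.1]

theorem Ioo_min_max_subset {a b : ℝ} (ha : a ∈ Icc (0 : ℝ) 1) (hb : b ∈ Icc (0 : ℝ) 1) :
    Ioo (min a b) (max a b) ⊆ Ioo 0 1 :=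
  Ioo_subset_Ioo (le_min ha.1 hb.1) (max_le ha.2 hb.2)

theorem uIcc_subset_unit {a b : ℝ} (ha : a ∈ Icc (0 : ℝ) 1) (hb : b ∈ Icc (0 : ℝ) 1) :
    uIcc a b ⊆ Icc 0 1 := uIcc_subset_Icc ha hb

/-- The equation along a characteristic in integrated form. -/
theorem HasCharDeriv.integral_eq (h : HasCharDeriv G u R T) (hu : Continuous u)
    (hR : Continuous R) (hM : G.M ≤ M) {ξ x s : ℝ} (hξ : ξ ∈ Icc (0 : ℝ) 1)
    (hx : x ∈ Icc (0 : ℝ) 1) (hs : T + M < s) :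
    ∫ η in x..ξ, R (η, G.flow (η, x, s)) = u (ξ, G.flow (ξ, x, s)) - u (x, s) := by
  have := intervalIntegral.integral_eq_sub_of_hasDeriv_right (a := x) (b := ξ)
    (f := fun η => u (η, G.flow (η, x, s))) (f' := fun η => R (η, G.flow (η, x, s)))
    (by fun_prop : Continuous fun η => u (η, G.flow (η, x, s))).continuousOn
    (fun η hη => by
      have hη' := Ioo_min_max_subset hx hξ hη
      exact (h.hasDerivAt_flow hη'
        (G.lt_flow hM (Ioo_subset_Icc_self hη') hx hs)).hasDerivWithinAt)
    ((by fun_prop : Continuous fun η => R (η, G.flow (η, x, s))).intervalIntegrable _ _)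
  simpa using this

/-- Differentiation in the starting value of an integral along a characteristic. -/
theorem HasTimeDeriv.integral_flow {v : ℝ × ℝ → ℝ} (h : HasTimeDeriv u v T) (hM : G.M ≤ M)
    {ξ x s : ℝ} (hξ : ξ ∈ Icc (0 : ℝ) 1) (hx : x ∈ Icc (0 : ℝ) 1) (hs : T + M < s) :
    HasDerivAt (fun s => ∫ η in x..ξ, u (η, G.flow (η, x, s)))
      (∫ η in x..ξ, v (η, G.flow (η, x, s)) * G.dflow (η, x, s)) s := by
  have hu := h.continuous_fun
  have hv := h.continuous_deriv
  refine hasDerivAt_integral_param (H := fun p => u (p.1, G.flow (p.1, x, p.2)))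
    (Hs := fun p => v (p.1, G.flow (p.1, x, p.2)) * G.dflow (p.1, x, p.2)) (by fun_prop)
    (by fun_prop) (S := Ioi (T + M)) isOpen_Ioi (fun η hη r hr => ?_) hs
  have hη' := uIcc_subset_unit hx hξ hη
  exact (h.hasDerivAt η hη' _ (G.lt_flow hM hη' hx hr)).comp r (G.hasDerivAt_flow_right η x r)

/-- If `u` has the derivative `R` along characteristics, and `u`, `R` have time derivatives `v`,
`Rt`, then `v` has the derivative `Rt - dg * v` along characteristics. -/
theorem HasCharDeriv.timeDeriv {v Rt : ℝ × ℝ → ℝ} (h : HasCharDeriv G u R T)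
    (hu : HasTimeDeriv u v T) (hR : HasTimeDeriv R Rt T) (hM : G.M ≤ M) :
    HasCharDeriv G v (fun z => Rt z - G.dg z * v z) (T + M) := by
  intro x hx t ht
  have hx' := Ioo_subset_Icc_self hx
  have hvc := hu.continuous_deriv
  have hRc := hR.continuous_deriv
  have key : ∀ ξ ∈ Icc (0 : ℝ) 1, v (ξ, G.flow (ξ, x, t)) = (v (x, t) +
      ∫ η in x..ξ, Rt (η, G.flow (η, x, t)) * G.dflow (η, x, t)) / G.dflow (ξ, x, t) := by
    intro ξ hξ
    have h1 : HasDerivAt (fun s => u (ξ, G.flow (ξ, x, s)))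
        (v (ξ, G.flow (ξ, x, t)) * G.dflow (ξ, x, t)) t :=
      HasDerivAt.comp (h₂ := fun r => u (ξ, r)) (h := fun s => G.flow (ξ, x, s)) t
        (hu.hasDerivAt ξ hξ _ (G.lt_flow hM hξ hx' ht)) (G.hasDerivAt_flow_right ξ x t)
    have h2 := (hu.hasDerivAt x hx' t (by linarith [G.M_nonneg])).add
      (hR.integral_flow hM hξ hx' ht)
    have h3 := h1.unique (h2.congr_of_eventuallyEq ?_)
    · rw [← h3, mul_div_cancel_right₀ _ (G.dflow_pos _).ne']
    · filter_upwards [Ioi_mem_nhds ht] with s hs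
      have := h.integral_eq hu.continuous_fun hR.continuous_fun hM hξ hx' hs
      simp only [Pi.add_apply]
      linarith
  have hc : Continuous fun η => Rt (η, G.flow (η, x, t)) * G.dflow (η, x, t) := by fun_prop
  have hint := intervalIntegral.integral_hasDerivAt_right (hc.intervalIntegrable x x)
    (hc.stronglyMeasurableAtFilter _ _) hc.continuousAt
  have hd := (hint.const_add (v (x, t))).div (G.hasDerivAt_dflow x x t) (G.dflow_pos _).ne'
  refine (hd.congr_deriv ?_).congr_of_eventuallyEq ?_
  · simp
    ring
  · filter_upwards [Icc_mem_nhds hx.1 hx.2] with ξ hξ using key ξ hξ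

/-- A function with derivatives along characteristics and in time is differentiable. -/
theorem HasCharDeriv.hasFDerivAt {v : ℝ × ℝ → ℝ} (h : HasCharDeriv G u R T)
    (hR : Continuous R) (hu : HasTimeDeriv u v T) {z : ℝ × ℝ} (hx : z.1 ∈ Ioo (0 : ℝ) 1)
    (ht : T < z.2) :
    HasFDerivAt u ((R z - G.g z * v z) • ContinuousLinearMap.fst ℝ ℝ ℝ
      + v z • ContinuousLinearMap.snd ℝ ℝ ℝ) z := by
  have hvc := hu.continuous_deriv
  have hnear : ∀ᶠ w : ℝ × ℝ in nhds z, w.1 ∈ Ioo (0 : ℝ) 1 ∧ T < w.2 :=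
    (continuous_fst.continuousAt.eventually (Ioo_mem_nhds hx.1 hx.2)).and
      (continuous_snd.continuousAt.eventually (Ioi_mem_nhds ht))
  refine hasFDerivAt_of_partial (Fx := fun z => R z - G.g z * v z) (Ft := v) ?_ ?_
    (Continuous.continuousAt (by fun_prop)) hvc.continuousAt
  · filter_upwards [hnear] with ⟨x, t⟩ ⟨hx, ht⟩
    simp only at hx ht
    -- coordinates `(ξ, s)` in which the characteristics are the lines `s = const`
    have hU : HasFDerivAt (fun w : ℝ × ℝ => u (w.1, G.flow (w.1, 0, w.2)))
        ((R (x, t)) • ContinuousLinearMap.fst ℝ ℝ ℝ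
          + (v (x, t) * G.dflow (x, 0, G.flow (0, x, t))) • ContinuousLinearMap.snd ℝ ℝ ℝ)
        (x, G.flow (0, x, t)) := by
      have hnear' : ∀ᶠ w : ℝ × ℝ in nhds (x, G.flow (0, x, t)), w.1 ∈ Ioo (0 : ℝ) 1 ∧
          T < G.flow (w.1, 0, w.2) := by
        refine (continuous_fst.continuousAt.eventually (Ioo_mem_nhds hx.1 hx.2)).and ?_
        have : Continuous fun w : ℝ × ℝ => G.flow (w.1, 0, w.2) := by fun_prop
        exact this.continuousAt.eventually (Ioi_mem_nhds (by simpa using ht))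
      have := hasFDerivAt_of_partial (F := fun w : ℝ × ℝ => u (w.1, G.flow (w.1, 0, w.2)))
        (Fx := fun w => R (w.1, G.flow (w.1, 0, w.2)))
        (Ft := fun w => v (w.1, G.flow (w.1, 0, w.2)) * G.dflow (w.1, 0, w.2))
        (z := (x, G.flow (0, x, t))) ?_ ?_ (Continuous.continuousAt (by fun_prop))
        (Continuous.continuousAt (by fun_prop))
      · simpa using this
      · filter_upwards [hnear'] with w hw using h.hasDerivAt_flow hw.1 hw.2
      · filter_upwards [hnear'] with w hw
        exact (hu.hasDerivAt w.1 (Ioo_subset_Icc_self hw.1) _ hw.2).comp w.2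
          (G.hasDerivAt_flow_right w.1 0 w.2)
    have := hasDerivAt_comp_curve (γ₁ := fun ξ => ξ) (γ₂ := fun ξ => G.flow (0, ξ, t)) hU
      (hasDerivAt_id x) (G.hasDerivAt_flow_base 0 x t)
    simp only [SpeedField.flow_flow, SpeedField.flow_self] at this
    refine this.congr_deriv ?_
    have h1 := G.dflow_mul_dflow x 0 x t
    rw [G.dflow_self] at h1
    linear_combination (-v (x, t) * G.g (x, t)) * h1
  · filter_upwards [hnear] with w hw
    exact hu.hasDerivAt w.1 (Ioo_subset_Icc_self hw.1) _ hw.2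

/-! ### Transversal integration -/

/-- If `w` is differentiable along the characteristics of `K`, then the integral of `w * (g - k)`
along a characteristic of `G` is a `C¹` function of the starting value, although `w` need not be
differentiable in any other direction. In the coordinates in which the characteristics of `K` are
horizontal, `(g - k) dη` is, up to a factor, the differential of the ordinate, so that a primitive
of `w` in the ordinate turns the integral into boundary terms and an integral of the derivative of
`w` along `K`. -/
theorem exists_hasDerivAt_integral_transversal {w w' : ℝ × ℝ → ℝ} (hw : Continuous w)
    (hw' : Continuous w') (h : HasCharDeriv K w w' T) (hGM : G.M ≤ M) (hKM : K.M ≤ M) {x₀ : ℝ}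
    (hx₀ : x₀ ∈ Icc (0 : ℝ) 1) :
    ∃ J : ℝ × ℝ → ℝ, Continuous J ∧ ∀ ξ ∈ Icc (0 : ℝ) 1, ∀ s, T + M + M + M < s →
      HasDerivAt (fun s => ∫ η in x₀..ξ, w (η, G.flow (η, x₀, s)) *
        (G.g (η, G.flow (η, x₀, s)) - K.g (η, G.flow (η, x₀, s)))) (J (ξ, s)) s := by
  have hM0 : 0 ≤ M := G.M_nonneg.trans hGM
  have h0 : (0 : ℝ) ∈ Icc (0 : ℝ) 1 := by simp
  set S : ℝ × ℝ → ℝ := fun p => K.flow (0, p.1, G.flow (p.1, x₀, p.2)) with hS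
  set Ss : ℝ × ℝ → ℝ := fun p =>
    K.dflow (0, p.1, G.flow (p.1, x₀, p.2)) * G.dflow (p.1, x₀, p.2) with hSs
  set W : ℝ × ℝ → ℝ := fun p => w (p.1, K.flow (p.1, 0, p.2)) * K.dflow (p.1, 0, p.2) with hW
  set W' : ℝ × ℝ → ℝ := fun p => (w' (p.1, K.flow (p.1, 0, p.2)) +
    w (p.1, K.flow (p.1, 0, p.2)) * K.dg (p.1, K.flow (p.1, 0, p.2))) * K.dflow (p.1, 0, p.2)
    with hW'
  have cS : Continuous S := by fun_prop
  have cSs : Continuous Ss := by fun_prop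
  have cW : Continuous W := by fun_prop
  have cW' : Continuous W' := by fun_prop
  have hSd : ∀ η s, HasDerivAt (fun s => S (η, s)) (Ss (η, s)) s := fun η s =>
    HasDerivAt.comp (h₂ := fun r => K.flow (0, η, r)) (h := fun s => G.flow (η, x₀, s)) s
      (K.hasDerivAt_flow_right 0 η _) (G.hasDerivAt_flow_right η x₀ s)
  have hWd : ∀ η ∈ Ioo (0 : ℝ) 1, ∀ σ, T + M < σ →
      HasDerivAt (fun η => W (η, σ)) (W' (η, σ)) η := fun η hη σ hσ => by
    refine HasDerivAt.congr_deriv ((h.hasDerivAt_flow hη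
      (K.lt_flow hKM (Ioo_subset_Icc_self hη) h0 hσ)).mul (K.hasDerivAt_dflow η 0 σ)) ?_
    simp only [hW']
    ring
  -- the primitives in the ordinate
  set A : ℝ × ℝ → ℝ := fun p => ∫ σ in (T + M + 1)..p.2, W (p.1, σ) with hA
  set A' : ℝ × ℝ → ℝ := fun p => ∫ σ in (T + M + 1)..p.2, W' (p.1, σ) with hA'
  have cA : Continuous A := by
    apply continuous_integral_of_continuous <;> fun_prop
  have cA' : Continuous A' := by
    apply continuous_integral_of_continuous <;> fun_prop
  have hprim : ∀ {V : ℝ × ℝ → ℝ} (_ : Continuous V) (η σ : ℝ),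
      HasDerivAt (fun σ => ∫ r in (T + M + 1)..σ, V (η, r)) (V (η, σ)) σ := fun {V} hV η σ => by
    have hc : Continuous fun r => V (η, r) := by fun_prop
    exact intervalIntegral.integral_hasDerivAt_right (hc.intervalIntegrable _ _)
      (hc.stronglyMeasurableAtFilter _ _) hc.continuousAt
  have hAx : ∀ η ∈ Ioo (0 : ℝ) 1, ∀ σ, T + M < σ →
      HasDerivAt (fun η => A (η, σ)) (A' (η, σ)) η := fun η hη σ hσ =>
    hasDerivAt_integral_param (H := fun p => W (p.2, p.1)) (Hs := fun p => W' (p.2, p.1))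
      (by fun_prop) (by fun_prop) isOpen_Ioo
      (fun r hr η hη => hWd η hη r
        (lt_of_lt_of_le (lt_min (by linarith) hσ) hr.1)) hη
  have hAd : ∀ η ∈ Ioo (0 : ℝ) 1, ∀ σ, T + M < σ → HasFDerivAt A
      (A' (η, σ) • ContinuousLinearMap.fst ℝ ℝ ℝ + W (η, σ) • ContinuousLinearMap.snd ℝ ℝ ℝ)
      (η, σ) := fun η hη σ hσ => by
    refine hasFDerivAt_of_partial (z := (η, σ)) ?_
      (Filter.Eventually.of_forall fun z => hprim cW z.1 z.2) cA'.continuousAt cW.continuousAt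
    have h1 : ∀ᶠ z : ℝ × ℝ in nhds (η, σ), z.1 ∈ Ioo (0 : ℝ) 1 :=
      continuous_fst.continuousAt.eventually (Ioo_mem_nhds hη.1 hη.2)
    have h2 : ∀ᶠ z : ℝ × ℝ in nhds (η, σ), T + M < z.2 :=
      continuous_snd.continuousAt.eventually (Ioi_mem_nhds hσ)
    filter_upwards [h1, h2] with z hz1 hz2 using hAx z.1 hz1 z.2 hz2
  have hlt : ∀ η ∈ Icc (0 : ℝ) 1, ∀ s, T + M + M + M < s → T + M < S (η, s) := fun η hη s hs =>
    K.lt_flow hKM h0 hη (G.lt_flow hGM hη hx₀ hs)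
  have cI : Continuous fun p : ℝ × ℝ => w (p.1, G.flow (p.1, x₀, p.2)) *
      (G.g (p.1, G.flow (p.1, x₀, p.2)) - K.g (p.1, G.flow (p.1, x₀, p.2))) := by fun_prop
  have hIc : ∀ {V : ℝ × ℝ → ℝ} (_ : Continuous V) (s a b : ℝ),
      IntervalIntegrable (fun η => V (η, s)) volume a b := fun {V} hV s a b =>
    (by fun_prop : Continuous fun η => V (η, s)).intervalIntegrable _ _
  have cAS : Continuous fun p : ℝ × ℝ => A' (p.1, S p) := by fun_prop
  have hformula : ∀ ξ ∈ Icc (0 : ℝ) 1, ∀ s, T + M + M + M < s →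
      ∫ η in x₀..ξ, w (η, G.flow (η, x₀, s)) *
        (G.g (η, G.flow (η, x₀, s)) - K.g (η, G.flow (η, x₀, s)))
      = A (ξ, S (ξ, s)) - A (x₀, S (x₀, s)) - ∫ η in x₀..ξ, A' (η, S (η, s)) := by
    intro ξ hξ s hs
    rw [eq_sub_iff_add_eq, ← intervalIntegral.integral_add (hIc cI s _ _) (hIc cAS s _ _)]
    refine intervalIntegral.integral_eq_sub_of_hasDeriv_right
      (f := fun η => A (η, S (η, s))) (by fun_prop) (fun η hη => ?_)
      ((hIc cI s _ _).add (hIc cAS s _ _))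
    have hη' := Ioo_min_max_subset hx₀ hξ hη
    have hSη : HasDerivAt (fun η => S (η, s)) (K.dflow (0, η, G.flow (η, x₀, s)) *
        (G.g (η, G.flow (η, x₀, s)) - K.g (η, G.flow (η, x₀, s)))) η := by
      have := hasDerivAt_comp_curve (γ₁ := fun ξ => ξ) (γ₂ := fun η => G.flow (η, x₀, s))
        (K.hasFDerivAt_flow 0 (η, G.flow (η, x₀, s))) (hasDerivAt_id η)
        (G.hasDerivAt_flow η x₀ s)
      exact this.congr_deriv (by ring)
    have := hasDerivAt_comp_curve (γ₁ := fun ξ => ξ) (γ₂ := fun η => S (η, s))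
      (hAd η hη' _ (hlt η (Ioo_subset_Icc_self hη') s hs)) (hasDerivAt_id η) hSη
    refine (this.congr_deriv ?_).hasDerivWithinAt
    have h1 := K.dflow_mul_dflow η 0 η (G.flow (η, x₀, s))
    rw [K.dflow_self] at h1
    simp only [hW, hS, SpeedField.flow_flow, SpeedField.flow_self]
    linear_combination (w (η, G.flow (η, x₀, s)) *
      (G.g (η, G.flow (η, x₀, s)) - K.g (η, G.flow (η, x₀, s)))) * h1
  refine ⟨fun p => W (p.1, S p) * Ss p - W (x₀, S (x₀, p.2)) * Ss (x₀, p.2)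
    - ∫ η in x₀..p.1, W' (η, S (η, p.2)) * Ss (η, p.2), ?_, fun ξ hξ s hs => ?_⟩
  · refine Continuous.sub (by fun_prop) ?_
    apply continuous_integral_of_continuous <;> fun_prop
  · have hb : ∀ η, HasDerivAt (fun s => A (η, S (η, s))) (W (η, S (η, s)) * Ss (η, s)) s :=
      fun η => HasDerivAt.comp (h₂ := fun σ => A (η, σ)) (h := fun s => S (η, s)) s
        (hprim cW η _) (hSd η s)
    have hi := hasDerivAt_integral_param (H := fun p => A' (p.1, S p))
      (Hs := fun p => W' (p.1, S p) * Ss p) (a := x₀) (b := ξ) cAS (by fun_prop) isOpen_univ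
      (fun η _ s _ => HasDerivAt.comp (h₂ := fun σ => A' (η, σ)) (h := fun s => S (η, s)) s
        (hprim cW' η _) (hSd η s)) (mem_univ s)
    refine (((hb ξ).sub (hb x₀)).sub hi).congr_of_eventuallyEq ?_
    filter_upwards [Ioi_mem_nhds hs] with r hr using hformula ξ hξ r hr

end

end HypSmoothing

end

noncomputable section

namespace HypSmoothing

/-! ### Time derivatives of continuous solutions -/

/-- The integrating factor that removes the diagonal coefficient `β` from the equation along the
characteristics of `G`. It is differentiable along the characteristics of any other field `K`. -/
theorem exists_integratingFactor {G : SpeedField} {β βt : ℝ × ℝ → ℝ} {T M : ℝ}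
    (hβ : HasTimeDeriv β βt T) (hGM : G.M ≤ M) {x₀ : ℝ} (hx₀ : x₀ ∈ Icc (0 : ℝ) 1) :
    ∃ e : ℝ × ℝ → ℝ, Continuous e ∧ (∀ z, 0 < e z) ∧ (∀ t, e (x₀, t) = 1) ∧
      HasCharDeriv G e (fun z => β z * e z) T ∧
      (∃ Es : ℝ × ℝ → ℝ, Continuous Es ∧ ∀ ξ ∈ Icc (0 : ℝ) 1, ∀ s, T + M < s →
        HasDerivAt (fun s => e (ξ, G.flow (ξ, x₀, s))) (Es (ξ, s)) s) ∧
      ∀ K : SpeedField, K.M ≤ M →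
        ∃ e' : ℝ × ℝ → ℝ, Continuous e' ∧ HasCharDeriv K e e' (T + M + M) := by
  have hM0 : 0 ≤ M := G.M_nonneg.trans hGM
  have cβ := hβ.continuous_fun
  have cβt := hβ.continuous_deriv
  set E : ℝ × ℝ → ℝ := fun p => Real.exp (∫ η in x₀..p.1, β (η, G.flow (η, x₀, p.2))) with hE
  set Es : ℝ × ℝ → ℝ := fun p =>
    E p * ∫ η in x₀..p.1, βt (η, G.flow (η, x₀, p.2)) * G.dflow (η, x₀, p.2) with hEs
  have cE : Continuous E := by
    refine Real.continuous_exp.comp ?_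
    apply continuous_integral_of_continuous <;> fun_prop
  have cEs : Continuous Es := by
    refine cE.mul ?_
    apply continuous_integral_of_continuous <;> fun_prop
  have hEx : ∀ ξ s, HasDerivAt (fun ξ => E (ξ, s)) (β (ξ, G.flow (ξ, x₀, s)) * E (ξ, s)) ξ := by
    intro ξ s
    have hc : Continuous fun η => β (η, G.flow (η, x₀, s)) := by fun_prop
    exact (intervalIntegral.integral_hasDerivAt_right (hc.intervalIntegrable x₀ ξ)
      (hc.stronglyMeasurableAtFilter _ _) hc.continuousAt).exp.congr_deriv (mul_comm _ _)
  have hEt : ∀ ξ ∈ Icc (0 : ℝ) 1, ∀ s, T + M < s →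
      HasDerivAt (fun s => E (ξ, s)) (Es (ξ, s)) s := fun ξ hξ s hs =>
    (hβ.integral_flow hGM hξ hx₀ hs).exp
  set e : ℝ × ℝ → ℝ := fun z => E (z.1, G.flow (x₀, z.1, z.2)) with he
  have heE : ∀ ξ s, e (ξ, G.flow (ξ, x₀, s)) = E (ξ, s) := fun ξ s => by simp [he]
  refine ⟨e, by fun_prop, fun z => Real.exp_pos _, fun t => by simp [he, hE], ?_,
    ⟨Es, cEs, fun ξ hξ s hs => ?_⟩, fun K hK => ?_⟩
  · intro x _ t _
    have hfun : (fun ξ => e (ξ, G.flow (ξ, x, t))) = fun ξ => E (ξ, G.flow (x₀, x, t)) := by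
      funext ξ
      simp [he]
    rw [hfun]
    exact (hEx x _).congr_deriv (by simp [he])
  · simpa only [heE] using hEt ξ hξ s hs
  · refine ⟨fun z => β z * e z + Es (z.1, G.flow (x₀, z.1, z.2)) *
      (G.dflow (x₀, z.1, z.2) * (K.g z - G.g z)), by fun_prop, fun x hx t ht => ?_⟩
    have hs : T + M < G.flow (x₀, x, t) :=
      G.lt_flow hGM hx₀ (Ioo_subset_Icc_self hx) ht
    have hEd := hasFDerivAt_of_partial (F := E) (Fx := fun p => β (p.1, G.flow (p.1, x₀, p.2)) * E p)
      (Ft := Es) (z := (x, G.flow (x₀, x, t)))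
      (Filter.Eventually.of_forall fun w => hEx w.1 w.2) ?_
      (Continuous.continuousAt (by fun_prop)) cEs.continuousAt
    · have hσ : HasDerivAt (fun ξ => G.flow (x₀, ξ, K.flow (ξ, x, t)))
          (G.dflow (x₀, x, t) * (K.g (x, t) - G.g (x, t))) x := by
        have := hasDerivAt_comp_curve (γ₁ := fun ξ => ξ) (γ₂ := fun ξ => K.flow (ξ, x, t)) (s := x)
          (G.hasFDerivAt_flow x₀ (x, K.flow (x, x, t))) (hasDerivAt_id x)
          (K.hasDerivAt_flow x x t)
        refine this.congr_deriv ?_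
        simp only [SpeedField.flow_self]
        ring
      have := hasDerivAt_comp_curve (γ₁ := fun ξ => ξ)
        (γ₂ := fun ξ => G.flow (x₀, ξ, K.flow (ξ, x, t))) (s := x)
        (by simpa using hEd) (hasDerivAt_id x) hσ
      exact this.congr_deriv (by simp [he])
    · have h1 : ∀ᶠ z : ℝ × ℝ in nhds (x, G.flow (x₀, x, t)), z.1 ∈ Ioo (0 : ℝ) 1 :=
        continuous_fst.continuousAt.eventually (Ioo_mem_nhds hx.1 hx.2)
      have h2 : ∀ᶠ z : ℝ × ℝ in nhds (x, G.flow (x₀, x, t)), T + M < z.2 :=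
        continuous_snd.continuousAt.eventually (Ioi_mem_nhds hs)
      filter_upwards [h1, h2] with z hz1 hz2 using hEt z.1 (Ioo_subset_Icc_self hz1) z.2 hz2

/-- A continuous function that satisfies an equation along the characteristics of `G` whose
coupling terms `B k * u k` are of the form `q k * (g - g k) * u k`, and that has `C¹` boundary values
at `x = x₀`, has a continuous time derivative after a finite time. The functions `u k` only have to
be differentiable along their own characteristics. -/
theorem exists_hasTimeDeriv {ι : Type*} {s : Finset ι} {G : SpeedField} {K : ι → SpeedField}
    {T M : ℝ} (hGM : G.M ≤ M) (hKM : ∀ k ∈ s, (K k).M ≤ M) {x₀ : ℝ} (hx₀ : x₀ ∈ Icc (0 : ℝ) 1)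
    {β βt F Ft u : ℝ × ℝ → ℝ} {B q q' U R : ι → ℝ × ℝ → ℝ} {h hd : ℝ → ℝ}
    (hβ : HasTimeDeriv β βt T) (hF : HasTimeDeriv F Ft T)
    (cB : ∀ k ∈ s, Continuous (B k))
    (cq : ∀ k ∈ s, Continuous (q k)) (cq' : ∀ k ∈ s, Continuous (q' k))
    (hq : ∀ k ∈ s, HasCharDeriv (K k) (q k) (q' k) T)
    (hBq : ∀ k ∈ s, ∀ x ∈ Icc (0 : ℝ) 1, ∀ t, T < t →
      B k (x, t) = q k (x, t) * (G.g (x, t) - (K k).g (x, t)))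
    (cU : ∀ k ∈ s, Continuous (U k)) (cR : ∀ k ∈ s, Continuous (R k))
    (hU : ∀ k ∈ s, HasCharDeriv (K k) (U k) (R k) T)
    (ch : Continuous hd) (hh : ∀ t, T < t → HasDerivAt h (hd t) t)
    (cu : Continuous u)
    (hu : HasCharDeriv G u (fun z => F z - β z * u z - ∑ k ∈ s, B k z * U k z) T)
    (hbd : ∀ t, T < t → u (x₀, t) = h t) :
    ∃ v, HasTimeDeriv u v (T + M + M + M + M + M + M) := by
  have hM0 : 0 ≤ M := G.M_nonneg.trans hGM
  have cF := hF.continuous_fun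
  have cFt := hF.continuous_deriv
  obtain ⟨e, ce, epos, e0, he, ⟨Es, cEs, hEs⟩, heK⟩ := exists_integratingFactor hβ hGM hx₀
  -- the coupling integrals are differentiable in the starting value
  have hJ : ∀ k ∈ s, ∃ J : ℝ × ℝ → ℝ, Continuous J ∧ ∀ ξ ∈ Icc (0 : ℝ) 1, ∀ r,
      T + M + M + M + M + M < r → HasDerivAt (fun r => ∫ η in x₀..ξ,
        e (η, G.flow (η, x₀, r)) * (B k (η, G.flow (η, x₀, r)) * U k (η, G.flow (η, x₀, r))))
        (J (ξ, r)) r := by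
    intro k hk
    obtain ⟨e', ce', he'⟩ := heK (K k) (hKM k hk)
    have h1 := (he'.mul ((hq k hk).mono (by linarith))).mul ((hU k hk).mono (by linarith))
    have := cq k hk
    have := cq' k hk
    have := cU k hk
    have := cR k hk
    obtain ⟨J, cJ, hJ⟩ := exists_hasDerivAt_integral_transversal (G := G) (by fun_prop)
      (by fun_prop) h1 hGM (hKM k hk) hx₀
    refine ⟨J, cJ, fun ξ hξ r hr => (hJ ξ hξ r hr).congr_of_eventuallyEq ?_⟩
    filter_upwards [Ioi_mem_nhds hr] with r hr
    refine intervalIntegral.integral_congr fun η hη => ?_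
    have hη' := uIcc_subset_unit hx₀ hξ hη
    have hr' : T + M + M + M + M + M < r := hr
    rw [hBq k hk η hη' _ (G.lt_flow hGM hη' hx₀ (by linarith))]
    ring
  choose! J cJ hJ using hJ
  set E : ℝ × ℝ → ℝ := fun p => e (p.1, G.flow (p.1, x₀, p.2)) with hE
  have cE : Continuous E := by fun_prop
  have Epos : ∀ p, 0 < E p := fun p => epos _
  set Z : ℝ × ℝ → ℝ := fun p => E p * u (p.1, G.flow (p.1, x₀, p.2)) with hZ
  have cZ : Continuous Z := by fun_prop
  set Zs : ℝ × ℝ → ℝ := fun p => hd p.2 + (∫ η in x₀..p.1,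
      (Es (η, p.2) * F (η, G.flow (η, x₀, p.2)) +
        E (η, p.2) * (Ft (η, G.flow (η, x₀, p.2)) * G.dflow (η, x₀, p.2))))
      - ∑ k ∈ s, J k p with hZs
  have cZs : Continuous Zs := by
    refine Continuous.sub (Continuous.add (by fun_prop) ?_) (continuous_finsetSum _ cJ)
    apply continuous_integral_of_continuous <;> fun_prop
  have hZd : ∀ ξ ∈ Icc (0 : ℝ) 1, ∀ r, T + M + M + M + M + M < r →
      HasDerivAt (fun r => Z (ξ, r)) (Zs (ξ, r)) r := by
    intro ξ hξ r hr
    have hFi := hasDerivAt_integral_param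
      (H := fun p => E p * F (p.1, G.flow (p.1, x₀, p.2)))
      (Hs := fun p => Es p * F (p.1, G.flow (p.1, x₀, p.2)) +
        E p * (Ft (p.1, G.flow (p.1, x₀, p.2)) * G.dflow (p.1, x₀, p.2)))
      (by fun_prop) (by fun_prop) (a := x₀) (b := ξ) (S := Ioi (T + M)) isOpen_Ioi
      (fun η hη r hr => by
        have hη' := uIcc_subset_unit hx₀ hξ hη
        exact (hEs η hη' r hr).mul (HasDerivAt.comp (h₂ := fun t => F (η, t))
          (h := fun r => G.flow (η, x₀, r)) r
          (hF.hasDerivAt η hη' _ (G.lt_flow hGM hη' hx₀ hr))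
          (G.hasDerivAt_flow_right η x₀ r)))
      (s := r) (show T + M < r by linarith)
    have hsum := HasDerivAt.fun_sum (u := s) fun k hk => hJ k hk ξ hξ r hr
    refine (((hh r (by linarith)).add hFi).sub hsum).congr_of_eventuallyEq ?_
    filter_upwards [Ioi_mem_nhds hr] with r hr
    have hr' : T + M < r := by
      have : T + M + M + M + M + M < r := hr
      linarith
    have hint : HasCharDeriv G (fun z => e z * u z)
        (fun z => e z * F z - ∑ k ∈ s, e z * (B k z * U k z)) T := by
      intro x hx t ht
      refine (he.mul hu x hx t ht).congr_deriv ?_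
      simp only [← Finset.mul_sum]
      ring
    have key := hint.integral_eq (by fun_prop)
      ((by fun_prop : Continuous fun z => e z * F z).sub (continuous_finsetSum _ fun k hk =>
        ce.mul ((cB k hk).mul (cU k hk)))) hGM hξ hx₀ hr'
    have hi1 : IntervalIntegrable (fun η => e (η, G.flow (η, x₀, r)) * F (η, G.flow (η, x₀, r)))
        volume x₀ ξ := Continuous.intervalIntegrable (by fun_prop) _ _
    have hi2 : ∀ k ∈ s, IntervalIntegrable (fun η => e (η, G.flow (η, x₀, r)) *
        (B k (η, G.flow (η, x₀, r)) * U k (η, G.flow (η, x₀, r)))) volume x₀ ξ := fun k hk => by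
      have := cB k hk
      have := cU k hk
      exact Continuous.intervalIntegrable (by fun_prop) _ _
    have hi3 : IntervalIntegrable (fun η => ∑ k ∈ s, e (η, G.flow (η, x₀, r)) *
        (B k (η, G.flow (η, x₀, r)) * U k (η, G.flow (η, x₀, r)))) volume x₀ ξ := by
      refine Continuous.intervalIntegrable (continuous_finsetSum _ fun k hk => ?_) _ _
      have := cB k hk
      have := cU k hk
      fun_prop
    rw [intervalIntegral.integral_sub hi1 hi3,
      intervalIntegral.integral_finsetSum hi2, e0, one_mul, hbd r (by linarith)] at key
    simp only [hZ, hE, Pi.add_apply, Pi.sub_apply]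
    linarith
  refine ⟨fun z => (Zs (z.1, G.flow (x₀, z.1, z.2)) * E (z.1, G.flow (x₀, z.1, z.2))
    - Z (z.1, G.flow (x₀, z.1, z.2)) * Es (z.1, G.flow (x₀, z.1, z.2)))
    / E (z.1, G.flow (x₀, z.1, z.2)) ^ 2 * G.dflow (x₀, z.1, z.2), cu, ?_, fun x hx t ht => ?_⟩
  · refine Continuous.mul (Continuous.div (by fun_prop) (by fun_prop) fun z => ?_) (by fun_prop)
    exact (pow_pos (Epos _) 2).ne'
  · have hs : T + M + M + M + M + M < G.flow (x₀, x, t) := G.lt_flow hGM hx₀ hx ht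
    have hq := (hZd x hx _ hs).div (hEs x hx _ (by linarith)) (Epos (x, _)).ne'
    refine (HasDerivAt.comp (h := fun t => G.flow (x₀, x, t)) t hq
      (G.hasDerivAt_flow_right x₀ x t)).congr_of_eventuallyEq ?_
    refine Filter.Eventually.of_forall fun r => ?_
    simp only [Function.comp_apply, Pi.div_apply, hZ, hE, SpeedField.flow_flow,
      SpeedField.flow_self]
    rw [mul_div_cancel_left₀ _ (epos _).ne']

end HypSmoothing

end

noncomputable section

namespace HypSmoothing

/-! ### Functions on closed strips -/

theorem closedStrip_anti {T T' : ℝ} (h : T ≤ T') : closedStrip T' ⊆ closedStrip T :=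
  prod_mono_right (Ici_subset_Ici.2 h)

theorem uniqueDiffOn_closedStrip (T : ℝ) : UniqueDiffOn ℝ (closedStrip T) :=
  (uniqueDiffOn_Icc zero_lt_one).prod (uniqueDiffOn_Ici T)

theorem closedStrip_mem_nhds {T : ℝ} {z : ℝ × ℝ} (hx : z.1 ∈ Ioo (0 : ℝ) 1) (ht : T < z.2) :
    closedStrip T ∈ nhds z :=
  prod_mem_nhds (Icc_mem_nhds hx.1 hx.2) (Ici_mem_nhds ht)

/-- The nearest-point retraction of the plane onto a closed strip. -/
def stripRetract (T : ℝ) (z : ℝ × ℝ) : ℝ × ℝ := (max 0 (min 1 z.1), max T z.2)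

@[fun_prop]
theorem continuous_stripRetract (T : ℝ) : Continuous (stripRetract T) := by
  unfold stripRetract
  fun_prop

theorem stripRetract_mem (T : ℝ) (z : ℝ × ℝ) : stripRetract T z ∈ closedStrip T :=
  ⟨⟨le_max_left _ _, max_le zero_le_one (min_le_left _ _)⟩, mem_Ici.2 (le_max_left _ _)⟩

theorem stripRetract_of_mem {T : ℝ} {z : ℝ × ℝ} (h : z ∈ closedStrip T) : stripRetract T z = z := by
  obtain ⟨⟨h0, h1⟩, h2⟩ := h
  exact Prod.ext (by simp [stripRetract, h0, h1]) (max_eq_right h2)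

theorem continuous_comp_stripRetract {F : ℝ × ℝ → ℝ} {T : ℝ} (hF : ContinuousOn F (closedStrip T)) :
    Continuous fun z => F (stripRetract T z) :=
  hF.comp_continuous (continuous_stripRetract T) (stripRetract_mem T)

theorem comp_stripRetract_eventuallyEq {F : ℝ × ℝ → ℝ} {T : ℝ} {z : ℝ × ℝ}
    (hx : z.1 ∈ Ioo (0 : ℝ) 1) (ht : T < z.2) :
    (fun z => F (stripRetract T z)) =ᶠ[nhds z] F := by
  filter_upwards [closedStrip_mem_nhds hx ht] with w hw
  rw [stripRetract_of_mem hw]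

/-- The derivative in the second variable of a function on the closed strip. -/
def timeDeriv (T : ℝ) (F : ℝ × ℝ → ℝ) (z : ℝ × ℝ) : ℝ := fderivWithin ℝ F (closedStrip T) z (0, 1)

/-- The derivative in the first variable of a function on the closed strip. -/
def spaceDeriv (T : ℝ) (F : ℝ × ℝ → ℝ) (z : ℝ × ℝ) : ℝ :=
  fderivWithin ℝ F (closedStrip T) z (1, 0)

section

variable {F : ℝ × ℝ → ℝ} {T : ℝ}

theorem contDiffOn_timeDeriv {k l : ℕ∞ω} (hF : ContDiffOn ℝ l F (closedStrip T))
    (hk : k + 1 ≤ l) : ContDiffOn ℝ k (timeDeriv T F) (closedStrip T) :=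
  (hF.fderivWithin (uniqueDiffOn_closedStrip T) hk).clm_apply contDiffOn_const

theorem continuousOn_timeDeriv (hF : ContDiffOn ℝ 1 F (closedStrip T)) :
    ContinuousOn (timeDeriv T F) (closedStrip T) :=
  (contDiffOn_timeDeriv (k := 0) hF (by simp)).continuousOn

theorem continuousOn_spaceDeriv (hF : ContDiffOn ℝ 1 F (closedStrip T)) :
    ContinuousOn (spaceDeriv T F) (closedStrip T) :=
  (hF.continuousOn_fderivWithin (uniqueDiffOn_closedStrip T) (by simp)).clm_apply
    continuousOn_const

theorem hasTimeDeriv_comp_stripRetract (hF : ContDiffOn ℝ 1 F (closedStrip T)) :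
    HasTimeDeriv (fun z => F (stripRetract T z)) (fun z => timeDeriv T F (stripRetract T z)) T := by
  refine ⟨continuous_comp_stripRetract hF.continuousOn,
    continuous_comp_stripRetract (continuousOn_timeDeriv hF), fun x hx t ht => ?_⟩
  have hz : (x, t) ∈ closedStrip T := ⟨hx, ht.le⟩
  have h1 := ((hF.differentiableOn (by simp)) (x, t) hz).hasFDerivWithinAt
  have h2 : HasDerivWithinAt (fun s : ℝ => (x, s)) ((0 : ℝ), (1 : ℝ)) (Ici T) t :=
    ((hasDerivAt_const t x).prodMk (hasDerivAt_id t)).hasDerivWithinAt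
  have h3 := (h1.comp_hasDerivWithinAt t h2 fun s hs => ⟨hx, hs⟩).hasDerivAt (Ici_mem_nhds ht)
  rw [stripRetract_of_mem hz]
  refine h3.congr_of_eventuallyEq ?_
  filter_upwards [Ici_mem_nhds ht] with s hs
  rw [stripRetract_of_mem ⟨hx, hs⟩]
  rfl

theorem hasCharDeriv_comp_stripRetract (hF : ContDiffOn ℝ 1 F (closedStrip T)) (K : SpeedField) :
    HasCharDeriv K (fun z => F (stripRetract T z)) (fun z => spaceDeriv T F (stripRetract T z)
      + timeDeriv T F (stripRetract T z) * K.g z) T := by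
  intro x hx t ht
  have hn : closedStrip T ∈ nhds (x, t) := closedStrip_mem_nhds hx ht
  have hz := mem_of_mem_nhds hn
  have h1 := (((hF.differentiableOn (by simp)) (x, t) hz).hasFDerivWithinAt.hasFDerivAt hn)
  have h2 : HasFDerivAt (fun z => F (stripRetract T z))
      (spaceDeriv T F (x, t) • ContinuousLinearMap.fst ℝ ℝ ℝ
        + timeDeriv T F (x, t) • ContinuousLinearMap.snd ℝ ℝ ℝ) (x, K.flow (x, x, t)) := by
    rw [K.flow_self]
    refine (h1.congr_of_eventuallyEq (comp_stripRetract_eventuallyEq hx ht)).congr_fderiv ?_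
    ext <;> simp [spaceDeriv, timeDeriv]
  have := hasDerivAt_comp_curve (γ₁ := fun ξ => ξ) (γ₂ := fun ξ => K.flow (ξ, x, t)) h2
    (hasDerivAt_id x) (K.hasDerivAt_flow x x t)
  refine this.congr_deriv ?_
  simp only [stripRetract_of_mem hz, K.flow_self, mul_one]

/-- A continuous function on a closed strip with `Cᵏ` partial derivatives is `Cᵏ⁺¹`. The partial
derivatives are only needed in the interior; they extend to the boundary. -/
theorem contDiffOn_succ_closedStrip {u ux ut : ℝ × ℝ → ℝ} {k : ℕ}
    (hu : ContinuousOn u (closedStrip T)) (hux : ContDiffOn ℝ k ux (closedStrip T))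
    (hut : ContDiffOn ℝ k ut (closedStrip T))
    (hd : ∀ z : ℝ × ℝ, z.1 ∈ Ioo (0 : ℝ) 1 → T < z.2 → HasFDerivAt u
      (ux z • ContinuousLinearMap.fst ℝ ℝ ℝ + ut z • ContinuousLinearMap.snd ℝ ℝ ℝ) z) :
    ContDiffOn ℝ (k + 1 : ℕ) u (closedStrip T) := by
  have hcl : closure (Ioo (0 : ℝ) 1 ×ˢ Ioi T) = closedStrip T := by
    rw [closure_prod_eq, closure_Ioo zero_ne_one, closure_Ioi, closedStrip]
  have hsub : Ioo (0 : ℝ) 1 ×ˢ Ioi T ⊆ closedStrip T := hcl ▸ subset_closure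
  have hL : ContDiffOn ℝ k (fun z => ux z • ContinuousLinearMap.fst ℝ ℝ ℝ
      + ut z • ContinuousLinearMap.snd ℝ ℝ ℝ) (closedStrip T) :=
    (hux.smul contDiffOn_const).add (hut.smul contDiffOn_const)
  push_cast
  rw [contDiffOn_succ_iff_hasFDerivWithinAt_of_uniqueDiffOn (uniqueDiffOn_closedStrip T)]
  refine ⟨fun h => by simp at h, _, hL, fun z hz => ?_⟩
  have := hasFDerivWithinAt_closure_of_tendsto_fderiv (f := u) (s := Ioo (0 : ℝ) 1 ×ˢ Ioi T)
    (x := z) (f' := ux z • ContinuousLinearMap.fst ℝ ℝ ℝ + ut z • ContinuousLinearMap.snd ℝ ℝ ℝ)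
    (fun w hw => (hd w hw.1 hw.2).differentiableAt.differentiableWithinAt)
    ((convex_Ioo _ _).prod (convex_Ioi _)) (isOpen_Ioo.prod isOpen_Ioi)
    (fun w hw => (hu w (hcl ▸ hw)).mono hsub) ?_
  · rwa [hcl] at this
  · refine Filter.Tendsto.congr' ?_ ((hL.continuousOn z hz).mono_left (nhdsWithin_mono _ hsub))
    filter_upwards [self_mem_nhdsWithin] with w hw using (hd w hw.1 hw.2).fderiv.symm

end

/-! ### Bootstrapping -/

/-- `u` is a continuous solution on `[0,1] × [T,∞)` of the system
`(∂ₓ + g_j ∂ₜ) u_j + ∑ₖ B_jk u_k = F_j`, understood along characteristics, with the boundary values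
`u_j(x₀ j, t) = h_j(t)`. -/
structure IsCharSolution {n : ℕ} (G : Fin n → SpeedField) (x₀ : Fin n → ℝ) (T : ℝ)
    (B : Fin n → Fin n → ℝ × ℝ → ℝ) (F : Fin n → ℝ × ℝ → ℝ) (h : Fin n → ℝ → ℝ)
    (u : Fin n → ℝ × ℝ → ℝ) : Prop where
  continuousOn : ∀ j, ContinuousOn (u j) (closedStrip T)
  hasCharDeriv : ∀ j, HasCharDeriv (G j) (u j) (fun z => F j z - ∑ k, B j k z * u k z) T
  boundary : ∀ j t, T < t → u j (x₀ j, t) = h j t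

/-- The Levy-type condition for the system in the form solved for the `x`-derivatives. -/
def IsLevy {n : ℕ} (G : Fin n → SpeedField) (T : ℝ) (B : Fin n → Fin n → ℝ × ℝ → ℝ) : Prop :=
  ∀ j k : Fin n, j ≠ k → ∃ q : ℝ × ℝ → ℝ, ContDiffOn ℝ 1 q (closedStrip T) ∧
    ∀ z ∈ closedStrip T, B j k z = q z * ((G j).g z - (G k).g z)

theorem IsLevy.mono {n : ℕ} {G : Fin n → SpeedField} {T T' : ℝ}
    {B : Fin n → Fin n → ℝ × ℝ → ℝ} (h : IsLevy G T B) (hT : T ≤ T') : IsLevy G T' B :=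
  fun j k hjk => (h j k hjk).imp fun _ hq =>
    ⟨hq.1.mono (closedStrip_anti hT), fun z hz => hq.2 z (closedStrip_anti hT hz)⟩

section

variable {n : ℕ} {G : Fin n → SpeedField} {x₀ : Fin n → ℝ} {T M : ℝ}
  {B : Fin n → Fin n → ℝ × ℝ → ℝ} {F : Fin n → ℝ × ℝ → ℝ} {h : Fin n → ℝ → ℝ}
  {u : Fin n → ℝ × ℝ → ℝ}

theorem IsCharSolution.mono (hu : IsCharSolution G x₀ T B F h u) {T' : ℝ} (hT : T ≤ T') :
    IsCharSolution G x₀ T' B F h u :=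
  ⟨fun j => (hu.continuousOn j).mono (closedStrip_anti hT), fun j => (hu.hasCharDeriv j).mono hT,
    fun j t ht => hu.boundary j t (hT.trans_lt ht)⟩

theorem HasCharDeriv.comp_stripRetract {K : SpeedField} {w R : ℝ × ℝ → ℝ}
    (hw : HasCharDeriv K w R T) :
    HasCharDeriv K (fun z => w (stripRetract T z)) (fun z => R (stripRetract T z)) T := by
  intro x hx t ht
  have hz : (x, t) ∈ closedStrip T := mem_of_mem_nhds (closedStrip_mem_nhds hx ht)
  have hc : ContinuousAt (fun ξ => (ξ, K.flow (ξ, x, t))) x := Continuous.continuousAt (by fun_prop)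
  simp only [stripRetract_of_mem hz]
  refine (hw x hx t ht).congr_of_eventuallyEq ?_
  refine hc.eventually (p := fun w' => w (stripRetract T w') = w w') ?_
  simp only [SpeedField.flow_self]
  exact comp_stripRetract_eventuallyEq hx ht

/-- After a finite time a continuous solution has continuous partial derivatives, and its time
derivative solves a system of the same form: the off-diagonal coefficients are unchanged, the
diagonal ones change by `∂ₜ g_j`, and the right-hand side contains `u` only undifferentiated. -/
theorem IsCharSolution.exists_timeDeriv (hM : ∀ j, (G j).M ≤ M) (hx₀ : ∀ j, x₀ j ∈ Icc (0 : ℝ) 1)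
    (hB : ∀ j k, ContDiffOn ℝ 1 (B j k) (closedStrip T))
    (hF : ∀ j, ContDiffOn ℝ 1 (F j) (closedStrip T)) (hh : ∀ j, ContDiffOn ℝ 1 (h j) (Ici T))
    (hlevy : IsLevy G T B) (hu : IsCharSolution G x₀ T B F h u) :
    ∃ T', T ≤ T' ∧ ∃ v : Fin n → ℝ × ℝ → ℝ,
      IsCharSolution G x₀ T' (fun j k z => B j k z + if j = k then (G j).dg z else 0)
        (fun j z => timeDeriv T (F j) z - ∑ k, timeDeriv T (B j k) z * u k z)
        (fun j => derivWithin (h j) (Ici T)) v ∧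
      ∀ j (z : ℝ × ℝ), z.1 ∈ Ioo (0 : ℝ) 1 → T' < z.2 → HasFDerivAt (u j)
        (((F j z - ∑ k, B j k z * u k z) - (G j).g z * v j z) • ContinuousLinearMap.fst ℝ ℝ ℝ
          + v j z • ContinuousLinearMap.snd ℝ ℝ ℝ) z := by
  classical
  -- without components nothing guarantees `0 ≤ M`
  rcases Nat.eq_zero_or_pos n with rfl | hn
  · exact ⟨T, le_rfl, u, ⟨fun j => j.elim0, fun j => j.elim0, fun j => j.elim0⟩, fun j => j.elim0⟩
  have hM0 : 0 ≤ M := (G ⟨0, hn⟩).M_nonneg.trans (hM _)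
  set T₁ := T + M + M + M + M + M + M with hT₁
  have hTT₁ : T ≤ T₁ := by linarith
  have tB := fun j k => hasTimeDeriv_comp_stripRetract (hB j k)
  have tF := fun j => hasTimeDeriv_comp_stripRetract (hF j)
  have cB := fun j k => (tB j k).continuous_fun
  have cF := fun j => (tF j).continuous_fun
  have cu := fun j => continuous_comp_stripRetract (hu.continuousOn j)
  have hchar := fun j => (hu.hasCharDeriv j).comp_stripRetract
  have cR : ∀ j, Continuous fun z => F j (stripRetract T z)
      - ∑ k, B j k (stripRetract T z) * u k (stripRetract T z) := fun j =>
    (cF j).sub (continuous_finsetSum _ fun k _ => (cB j k).mul (cu k))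
  have hhd : ∀ j t, T < t → HasDerivAt (h j) (derivWithin (h j) (Ici T) t) t := fun j t ht =>
    (((hh j).differentiableOn (by simp)) t (le_of_lt ht)).hasDerivWithinAt.hasDerivAt
      (Ici_mem_nhds ht)
  have chd : ∀ j, Continuous fun t => derivWithin (h j) (Ici T) (max T t) := fun j =>
    ((hh j).continuousOn_derivWithin (uniqueDiffOn_Ici T) le_rfl).comp_continuous (by fun_prop)
      fun t => mem_Ici.2 (le_max_left _ _)
  choose! q hq hBq using hlevy
  have hv : ∀ j, ∃ v, HasTimeDeriv (fun z => u j (stripRetract T z)) v T₁ := by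
    intro j
    have hne : ∀ k ∈ Finset.univ.erase j, j ≠ k := fun k hk => (Finset.ne_of_mem_erase hk).symm
    have hchar' : HasCharDeriv (G j) (fun z => u j (stripRetract T z)) (fun z =>
        F j (stripRetract T z) - B j j (stripRetract T z) * u j (stripRetract T z)
          - ∑ k ∈ Finset.univ.erase j, B j k (stripRetract T z) * u k (stripRetract T z)) T := by
      intro x hx t ht
      refine (hchar j x hx t ht).congr_deriv ?_
      simp only [← Finset.add_sum_erase _ _ (Finset.mem_univ j)]
      ring
    refine exists_hasTimeDeriv (s := Finset.univ.erase j) (K := G)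
      (B := fun k z => B j k (stripRetract T z)) (q := fun k z => q j k (stripRetract T z))
      (U := fun k z => u k (stripRetract T z)) (h := h j)
      (hM j) (fun k _ => hM k) (hx₀ j) (tB j j) (tF j) (fun k _ => cB j k)
      (fun k hk => continuous_comp_stripRetract (hq j k (hne k hk)).continuousOn)
      (fun k hk => ?_) (fun k hk => hasCharDeriv_comp_stripRetract (hq j k (hne k hk)) (G k))
      (fun k hk x hx t ht => ?_) (fun k _ => cu k) (fun k _ => cR k) (fun k _ => hchar k) (chd j)
      (fun t ht => ?_) (cu j) hchar' (fun t ht => ?_)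
    · have h1 := continuous_comp_stripRetract (continuousOn_timeDeriv (hq j k (hne k hk)))
      have h2 := continuous_comp_stripRetract (continuousOn_spaceDeriv (hq j k (hne k hk)))
      fun_prop
    · have hz : (x, t) ∈ closedStrip T := ⟨hx, ht.le⟩
      simp only [stripRetract_of_mem hz]
      exact hBq j k (hne k hk) _ hz
    · rw [max_eq_right ht.le]
      exact hhd j t ht
    · have hz : (x₀ j, t) ∈ closedStrip T := ⟨hx₀ j, ht.le⟩
      rw [stripRetract_of_mem hz]
      exact hu.boundary j t ht
  choose v hv using hv
  have tR : ∀ j, HasTimeDeriv (fun z => F j (stripRetract T z)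
      - ∑ k, B j k (stripRetract T z) * u k (stripRetract T z))
      (fun z => timeDeriv T (F j) (stripRetract T z)
        - ∑ k, (timeDeriv T (B j k) (stripRetract T z) * u k (stripRetract T z)
          + B j k (stripRetract T z) * v k z)) T₁ := by
    intro j
    refine ⟨cR j, (tF j).continuous_deriv.sub (continuous_finsetSum _ fun k _ =>
      ((tB j k).continuous_deriv.mul (cu k)).add ((cB j k).mul (hv k).continuous_deriv)),
      fun x hx t ht => ?_⟩
    have ht' : T < t := hTT₁.trans_lt ht
    exact ((tF j).hasDerivAt x hx t ht').sub (HasDerivAt.fun_sum fun k _ =>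
      ((tB j k).hasDerivAt x hx t ht').mul ((hv k).hasDerivAt x hx t ht))
  refine ⟨T₁ + M, by linarith, v, ⟨fun j => (hv j).continuous_deriv.continuousOn, fun j => ?_,
    fun j t ht => ?_⟩, fun j z hx ht => ?_⟩
  · intro x hx t ht
    have hz : (x, t) ∈ closedStrip T := ⟨Ioo_subset_Icc_self hx, by
      have : T < t := by linarith
      exact this.le⟩
    refine (((hchar j).mono hTT₁).timeDeriv (hv j) (tR j) (hM j) x hx t ht).congr_deriv ?_
    simp only [stripRetract_of_mem hz, add_mul, ite_mul, zero_mul, Finset.sum_add_distrib,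
      Finset.sum_ite_eq, Finset.mem_univ, if_true]
    ring
  · have ht₁ : T₁ < t := by linarith
    refine ((hv j).hasDerivAt _ (hx₀ j) t ht₁).unique
      ((hhd j t (hTT₁.trans_lt ht₁)).congr_of_eventuallyEq ?_)
    filter_upwards [Ioi_mem_nhds (hTT₁.trans_lt ht₁)] with s hs
    have hz : (x₀ j, s) ∈ closedStrip T := ⟨hx₀ j, mem_Ici.2 (le_of_lt hs)⟩
    rw [stripRetract_of_mem hz]
    exact hu.boundary j s hs
  · have ht₁ : T₁ < z.2 := by linarith
    have ht' : T < z.2 := hTT₁.trans_lt ht₁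
    have := ((hchar j).mono hTT₁).hasFDerivAt (cR j) (hv j) hx ht₁
    simp only [stripRetract_of_mem (mem_of_mem_nhds (closedStrip_mem_nhds hx ht'))] at this
    exact this.congr_of_eventuallyEq (comp_stripRetract_eventuallyEq hx ht').symm

/-- Every continuous solution is `Cᵏ` after a finite time depending on `k`. -/
theorem IsCharSolution.exists_contDiffOn {T₀ : ℝ} (hM : ∀ j, (G j).M ≤ M)
    (hx₀ : ∀ j, x₀ j ∈ Icc (0 : ℝ) 1)
    (hg : ∀ j, ContDiffOn ℝ ∞ (G j).g (closedStrip T₀))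
    (hdg : ∀ j, ContDiffOn ℝ ∞ (G j).dg (closedStrip T₀)) (k : ℕ) (hT : T₀ ≤ T)
    (hB : ∀ j k, ContDiffOn ℝ ∞ (B j k) (closedStrip T))
    (hF : ∀ j, ContDiffOn ℝ k (F j) (closedStrip T)) (hh : ∀ j, ContDiffOn ℝ ∞ (h j) (Ici T))
    (hlevy : IsLevy G T B) (hu : IsCharSolution G x₀ T B F h u) :
    ∃ T', T ≤ T' ∧ ∀ j, ContDiffOn ℝ k (u j) (closedStrip T') := by
  classical
  induction k generalizing T B F h u with
  | zero =>
    exact ⟨T, le_rfl, fun j => by simpa using! hu.continuousOn j⟩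
  | succ k ih =>
    obtain ⟨T₁, hT₁, hu₁⟩ := ih hT hB (fun j => (hF j).of_le (by simp)) hh hlevy hu
    obtain ⟨T₂, hT₂, v, hv, hd⟩ := hu.exists_timeDeriv hM hx₀ (fun j k => (hB j k).of_le (by simp))
      (fun j => (hF j).of_le (by simp)) (fun j => (hh j).of_le (by simp)) hlevy
    set T₃ := max T₁ T₂ with hT₃
    have h1 : T₁ ≤ T₃ := le_max_left _ _
    have h2 : T₂ ≤ T₃ := le_max_right _ _
    have h3 : T ≤ T₃ := hT₁.trans h1
    have hT₀ : closedStrip T₃ ⊆ closedStrip T₀ := closedStrip_anti (hT.trans h3)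
    have hsub : closedStrip T₃ ⊆ closedStrip T := closedStrip_anti h3
    have hB₃ : ∀ j k, ContDiffOn ℝ ∞
        (fun z => B j k z + if j = k then (G j).dg z else 0) (closedStrip T₃) := by
      intro j k
      refine ((hB j k).mono hsub).add ?_
      split_ifs
      · exact (hdg j).mono hT₀
      · exact contDiffOn_const
    have hF₃ : ∀ j, ContDiffOn ℝ k
        (fun z => timeDeriv T (F j) z - ∑ k, timeDeriv T (B j k) z * u k z) (closedStrip T₃) :=
      fun j => ((contDiffOn_timeDeriv (hF j) (by simp)).mono hsub).sub
        (ContDiffOn.sum fun l _ => ContDiffOn.mul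
          ((contDiffOn_timeDeriv (hB j l) (by exact_mod_cast le_top)).mono hsub)
          ((hu₁ l).mono (closedStrip_anti h1)))
    have hh₃ : ∀ j, ContDiffOn ℝ ∞ (derivWithin (h j) (Ici T)) (Ici T₃) := fun j =>
      ((hh j).derivWithin (uniqueDiffOn_Ici T) (by simp)).mono (Ici_subset_Ici.2 h3)
    have hlevy₃ : IsLevy G T₃ (fun j k z => B j k z + if j = k then (G j).dg z else 0) := by
      intro j k hjk
      obtain ⟨q, hq, hBq⟩ := hlevy.mono h3 j k hjk
      exact ⟨q, hq, fun z hz => by simp [hjk, hBq z hz]⟩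
    obtain ⟨T₄, hT₄, hv₄⟩ := ih (hT.trans h3) hB₃ hF₃ hh₃ hlevy₃ (hv.mono h2)
    have hs₁ : closedStrip T₄ ⊆ closedStrip T₁ := closedStrip_anti (h1.trans hT₄)
    have hs : closedStrip T₄ ⊆ closedStrip T := closedStrip_anti (h3.trans hT₄)
    refine ⟨T₄, h3.trans hT₄, fun j => contDiffOn_succ_closedStrip
      ((hu.continuousOn j).mono hs) ?_ (hv₄ j)
      (fun z hx ht => hd j z hx ((h2.trans hT₄).trans_lt ht))⟩
    refine ContDiffOn.sub (ContDiffOn.sub (((hF j).of_le (by simp)).mono hs)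
      (ContDiffOn.sum fun l _ => ?_)) (ContDiffOn.mul ?_ (hv₄ j))
    · exact (((hB j l).of_le (by exact_mod_cast le_top)).mono hs).mul ((hu₁ l).mono hs₁)
    · exact ((hg j).of_le (by exact_mod_cast le_top)).mono
        (closedStrip_anti (hT.trans (h3.trans hT₄)))

end

end HypSmoothing

end

noncomputable section

namespace HypSmoothing

/-! ### From the integral equations to the equations along characteristics -/

/-- The reciprocal of the speed `a` extends from `[0,1] × [2,∞)` to a right-hand side defined on
the whole plane. -/
theorem exists_speedField {a : ℝ × ℝ → ℝ} {c : ℝ} (ha : ContDiffOn ℝ ∞ a (closedStrip 0))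
    (hc : 0 < c) (hac : ∀ z ∈ closedStrip 0, c ≤ |a z|) :
    ∃ G : SpeedField, (∀ z ∈ closedStrip 2, G.g z = 1 / a z) ∧
      (∀ z ∈ closedStrip 0, |1 / a z| ≤ G.M) ∧
      ContDiffOn ℝ ∞ G.g (closedStrip 2) ∧ ContDiffOn ℝ ∞ G.dg (closedStrip 2) := by
  have h02 : closedStrip 2 ⊆ closedStrip 0 := closedStrip_anti (by norm_num)
  have ha0 : ∀ z ∈ closedStrip 0, a z ≠ 0 := fun z hz => abs_pos.1 (hc.trans_le (hac z hz))
  have hbound : ∀ z ∈ closedStrip 0, |1 / a z| ≤ 1 / c := fun z hz => by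
    rw [abs_div, abs_one]
    exact one_div_le_one_div_of_le hc (hac z hz)
  have hr : ContDiffOn ℝ ∞ (fun z => 1 / a z) (closedStrip 0) := contDiffOn_const.div ha ha0
  have hr1 : ContDiffOn ℝ 1 (fun z => 1 / a z) (closedStrip 0) := hr.of_le (by simp)
  have hD := hasTimeDeriv_comp_stripRetract hr1
  -- a smooth reparametrization of time that keeps away from `t = 0` and is the identity for `t ≥ 2`
  set χ : ℝ → ℝ := fun t => 1 + (t - 1) * Real.smoothTransition (t - 1) with hχ
  have hχs : ContDiff ℝ ∞ χ := by
    have : ContDiff ℝ ∞ Real.smoothTransition := Real.smoothTransition.contDiff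
    exact contDiff_const.add ((contDiff_id.sub contDiff_const).mul
      (this.comp (contDiff_id.sub contDiff_const)))
  have hχd : ContDiff ℝ ∞ (deriv χ) := (contDiff_infty_iff_deriv.1 hχs).2
  have hχ2 : ∀ t, 2 ≤ t → χ t = t := fun t ht => by
    simp only [hχ, Real.smoothTransition.one_of_one_le (by linarith : 1 ≤ t - 1)]
    ring
  have hχpos : ∀ t, 0 < χ t := fun t => by
    rcases le_total t 1 with ht | ht
    · simp [hχ, Real.smoothTransition.zero_of_nonpos (by linarith : t - 1 ≤ 0)]
    · have := mul_nonneg (sub_nonneg.2 ht) (Real.smoothTransition.nonneg (t - 1))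
      simp only [hχ]
      linarith
  have hmem : ∀ x : ℝ, max 0 (min 1 x) ∈ Icc (0 : ℝ) 1 := fun x =>
    ⟨le_max_left _ _, max_le zero_le_one (min_le_left _ _)⟩
  have cχ := hχs.continuous
  have cχd := hχd.continuous
  have cg := hD.continuous_fun
  have cdg := hD.continuous_deriv
  have hid : ∀ z ∈ closedStrip 2, ((max 0 (min 1 z.1), χ z.2) : ℝ × ℝ) = z := fun z hz =>
    Prod.ext (by simp [hz.1.1, hz.1.2]) (hχ2 _ hz.2)
  let G : SpeedField :=
    { g := fun z => 1 / a (stripRetract 0 (max 0 (min 1 z.1), χ z.2))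
      dg := fun z => timeDeriv 0 (fun z => 1 / a z) (stripRetract 0 (max 0 (min 1 z.1), χ z.2))
        * deriv χ z.2
      M := 1 / c
      continuous_g := cg.comp (by fun_prop : Continuous fun z : ℝ × ℝ => (max 0 (min 1 z.1), χ z.2))
      continuous_dg := (cdg.comp
        (by fun_prop : Continuous fun z : ℝ × ℝ => (max 0 (min 1 z.1), χ z.2))).mul (by fun_prop)
      hasDerivAt_g := fun x t => HasDerivAt.comp
        (h₂ := fun s => 1 / a (stripRetract 0 (max 0 (min 1 x), s))) t
        (hD.hasDerivAt _ (hmem x) _ (hχpos t))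
        ((hχs.differentiable (by simp)) t).hasDerivAt
      bound := fun z => hbound _ (stripRetract_mem _ _) }
  have hg : ∀ z ∈ closedStrip 2, G.g z = 1 / a z := fun z hz => by
    simp only [G, hid z hz, stripRetract_of_mem (h02 hz)]
  have hdg : ∀ z ∈ closedStrip 2, G.dg z = timeDeriv 0 (fun z => 1 / a z) z * deriv χ z.2 :=
    fun z hz => by simp only [G, hid z hz, stripRetract_of_mem (h02 hz)]
  refine ⟨G, hg, hbound, (hr.mono h02).congr hg, ContDiffOn.congr ?_ hdg⟩
  exact ((contDiffOn_timeDeriv hr (by simp)).mono h02).mul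
    (hχd.comp contDiff_snd).contDiffOn

/-- For large times a backward characteristic reaches the inflow side, and it is a piece of an
orbit of the flow. -/
theorem IsBackwardCharacteristic.eq_flow {a : ℝ × ℝ → ℝ} {inflow x t y : ℝ} {w : ℝ → ℝ}
    (hw : IsBackwardCharacteristic a inflow x t y w) {G : SpeedField}
    (hg : ∀ z ∈ closedStrip 2, G.g z = 1 / a z) (ha : ∀ z ∈ closedStrip 0, |1 / a z| ≤ G.M)
    (hx : x ∈ Icc (0 : ℝ) 1) (ht : 2 + G.M < t) :
    y = inflow ∧ ∀ ξ ∈ uIcc y x, w ξ = G.flow (ξ, x, t) := by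
  have hsub : uIcc y x ⊆ Icc 0 1 := uIcc_subset_unit hw.abscissa_mem hx
  have hlow : ∀ ξ ∈ uIcc y x, 2 < w ξ := fun ξ hξ => by
    have h1 := (convex_uIcc y x).norm_image_sub_le_of_norm_hasDerivWithin_le hw.ode
      (fun η hη => ha (η, w η) ⟨hsub hη, hw.nonneg η hη⟩) right_mem_uIcc hξ
    rw [hw.initial, Real.norm_eq_abs, Real.norm_eq_abs] at h1
    have h2 : |ξ - x| ≤ 1 := by
      have h3 := hsub hξ
      exact abs_le.2 ⟨by linarith [h3.1, hx.2], by linarith [h3.2, hx.1]⟩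
    have h4 := mul_le_mul_of_nonneg_left h2 G.M_nonneg
    linarith [(abs_le.1 h1).1]
  refine ⟨hw.boundary.resolve_right fun h0 => ?_, fun ξ hξ => ?_⟩
  · linarith [hlow y left_mem_uIcc]
  · have hs : uIcc x ξ ⊆ uIcc y x := uIcc_subset_uIcc right_mem_uIcc hξ
    refine SpeedField.IsSolutionBetween.unique (G := G) (a := x)
      (w₂ := fun ξ => G.flow (ξ, x, t))
      ⟨fun η hη => ((hw.ode η (hs hη)).continuousWithinAt).mono hs, fun η hη => ?_⟩
      (G.isSolutionBetween_flow x t x ξ) (hw.initial.trans (G.flow_self x t).symm)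
    have hη' := hs (Ioo_subset_Icc_self hη)
    have hz : (η, w η) ∈ closedStrip 2 := ⟨hsub hη', (hlow η hη').le⟩
    rw [hg _ hz]
    exact (hw.ode η hη').hasDerivAt (Filter.mem_of_superset (Icc_mem_nhds hη.1 hη.2) hs)

/-- Differentiation of the variation of constants formula along a characteristic. -/
theorem hasCharDeriv_of_variation_of_constants {G : SpeedField} {β Q u : ℝ × ℝ → ℝ} {h : ℝ → ℝ}
    {T x₀ : ℝ} (hβ : Continuous β) (hQ : Continuous Q)
    (hu : ∀ x ∈ Icc (0 : ℝ) 1, ∀ t, T < t → u (x, t) =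
      Real.exp (∫ η in x..x₀, β (η, G.flow (η, x, t))) * h (G.flow (x₀, x, t)) +
        ∫ ξ in x₀..x, Real.exp (∫ η in x..ξ, β (η, G.flow (η, x, t))) *
          Q (ξ, G.flow (ξ, x, t))) :
    HasCharDeriv G u (fun z => Q z - β z * u z) T := by
  intro x hx t ht
  have cβ : Continuous fun η => β (η, G.flow (η, x, t)) := by fun_prop
  set P : ℝ → ℝ := fun ξ => ∫ η in x₀..ξ, β (η, G.flow (η, x, t)) with hP
  have hPd : ∀ ξ, HasDerivAt P (β (ξ, G.flow (ξ, x, t))) ξ := fun ξ =>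
    intervalIntegral.integral_hasDerivAt_right (cβ.intervalIntegrable _ _)
      (cβ.stronglyMeasurableAtFilter _ _) cβ.continuousAt
  have cP : Continuous P := continuous_iff_continuousAt.2 fun ξ => (hPd ξ).continuousAt
  have hPsub : ∀ a b, ∫ η in a..b, β (η, G.flow (η, x, t)) = P b - P a := fun a b =>
    (intervalIntegral.integral_interval_sub_left (cβ.intervalIntegrable _ _)
      (cβ.intervalIntegrable _ _)).symm
  have cI : Continuous fun η => Real.exp (P η) * Q (η, G.flow (η, x, t)) := by fun_prop
  have hform : ∀ ξ ∈ Icc (0 : ℝ) 1, T < G.flow (ξ, x, t) → u (ξ, G.flow (ξ, x, t)) =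
      Real.exp (-P ξ) * (h (G.flow (x₀, x, t)) +
        ∫ η in x₀..ξ, Real.exp (P η) * Q (η, G.flow (η, x, t))) := by
    intro ξ hξ hlt
    rw [hu ξ hξ _ hlt]
    simp only [SpeedField.flow_flow, hPsub]
    have hP0 : P x₀ = 0 := by simp [hP]
    rw [hP0, zero_sub, mul_add, ← intervalIntegral.integral_const_mul]
    congr 1
    refine intervalIntegral.integral_congr fun η _ => ?_
    simp only [sub_eq_add_neg, Real.exp_add]
    ring
  have hd := ((hPd x).neg.exp).mul ((intervalIntegral.integral_hasDerivAt_right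
    (cI.intervalIntegrable x₀ x) (cI.stronglyMeasurableAtFilter _ _) cI.continuousAt).const_add
      (h (G.flow (x₀, x, t))))
  refine (hd.congr_of_eventuallyEq ?_).congr_deriv ?_
  · have hc : Continuous fun ξ => G.flow (ξ, x, t) := by fun_prop
    filter_upwards [Icc_mem_nhds hx.1 hx.2, hc.continuousAt.eventually
      (Ioi_mem_nhds (by simpa using ht))] with ξ h1 h2 using hform ξ h1 h2
  · have := hform x (Ioo_subset_Icc_self hx) (by simpa using ht)
    rw [G.flow_self] at this
    simp only [Pi.neg_apply, G.flow_self]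
    rw [this]
    have hE : Real.exp (-P x) * Real.exp (P x) = 1 := by
      rw [← Real.exp_add, neg_add_cancel, Real.exp_zero]
    linear_combination Q (x, t) * hE

theorem inflowSide_mem {n : ℕ} (m : ℕ) (j : Fin n) : inflowSide m j ∈ Icc (0 : ℝ) 1 := by
  unfold inflowSide
  split_ifs <;> simp

/-- For large times a continuous solution of the initial-boundary value problem solves the system
along characteristics; the initial values are no longer felt. -/
theorem IsContinuousSolution.isCharSolution {n m : ℕ} {a : Fin n → ℝ × ℝ → ℝ}
    {b : Fin n → Fin n → ℝ × ℝ → ℝ} {f : Fin n → ℝ × ℝ → ℝ} {h φ : Fin n → ℝ → ℝ}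
    {u : Fin n → ℝ × ℝ → ℝ} {G : Fin n → SpeedField} {T : ℝ}
    (hg : ∀ j, ∀ z ∈ closedStrip 2, (G j).g z = 1 / a j z)
    (ha : ∀ j, ∀ z ∈ closedStrip 0, |1 / a j z| ≤ (G j).M)
    (hT₀ : 2 ≤ T) (hT : ∀ j, 2 + (G j).M ≤ T)
    (hb : ∀ j k, ContinuousOn (b j k) (closedStrip 0)) (hf : ∀ j, ContinuousOn (f j) (closedStrip 0))
    (hu : IsContinuousSolution m a b f h φ u) :
    IsCharSolution G (inflowSide m) T (fun j k z => b j k z / a j z) (fun j z => f j z / a j z)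
      h u := by
  classical
  have h02 : closedStrip 2 ⊆ closedStrip 0 := closedStrip_anti (by norm_num)
  refine ⟨fun j => (hu.1 j).mono (closedStrip_anti (by linarith)), fun j => ?_, fun j t ht => ?_⟩
  · have cga : ContinuousOn (fun z => 1 / a j z) (closedStrip 2) :=
      (G j).continuous_g.continuousOn.congr fun z hz => (hg j z hz).symm
    have cβ : ContinuousOn (fun z => b j j z / a j z) (closedStrip 2) :=
      (((hb j j).mono h02).mul cga).congr fun z _ => by simp only [Pi.mul_apply]; ring
    have cfa : ContinuousOn (fun z => f j z / a j z) (closedStrip 2) :=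
      (((hf j).mono h02).mul cga).congr fun z _ => by simp only [Pi.mul_apply]; ring
    have cS : ContinuousOn (fun z => ∑ k ∈ Finset.univ.filter (fun k => k ≠ j),
        b j k z / a j z * u k z) (closedStrip 2) := by
      refine continuousOn_finsetSum _ fun k _ => ?_
      exact ((((hb j k).mono h02).mul cga).mul ((hu.1 k).mono h02)).congr fun z _ => by
        simp only [Pi.mul_apply]; ring
    have key := hasCharDeriv_of_variation_of_constants (G := G j) (u := u j) (h := h j) (T := T)
      (x₀ := inflowSide m j) (continuous_comp_stripRetract cβ) (continuous_comp_stripRetract (cfa.sub cS)) ?_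
    · intro x hx t ht
      refine (key x hx t ht).congr_deriv ?_
      have hz : (x, t) ∈ closedStrip 2 := ⟨Ioo_subset_Icc_self hx, hT₀.trans ht.le⟩
      simp only [stripRetract_of_mem hz, Finset.filter_ne', Pi.sub_apply,
        ← Finset.add_sum_erase Finset.univ _ (Finset.mem_univ j)]
      ring
    · intro x hx t ht
      obtain ⟨y, w, hw, hrep⟩ := hu.2 j x hx t (by
        have : 2 ≤ t := hT₀.trans ht.le
        exact mem_Ici.2 (by linarith))
      obtain ⟨rfl, hflow⟩ := hw.eq_flow (hg j) (ha j) hx ((hT j).trans_lt ht)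
      have hmem : ∀ ξ ∈ uIcc (inflowSide m j) x, (ξ, (G j).flow (ξ, x, t)) ∈ closedStrip 2 :=
        fun ξ hξ => by
          have hξ' := uIcc_subset_unit (inflowSide_mem m j) hx hξ
          exact ⟨hξ', ((G j).lt_flow le_rfl hξ' hx ((hT j).trans_lt ht)).le⟩
      have hc : ∀ ξ ∈ uIcc (inflowSide m j) x, cFun a b j w x ξ = Real.exp (∫ η in x..ξ,
          b j j (stripRetract 2 (η, (G j).flow (η, x, t))) /
            a j (stripRetract 2 (η, (G j).flow (η, x, t)))) := fun ξ hξ => by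
        unfold cFun
        congr 1
        refine intervalIntegral.integral_congr fun η hη => ?_
        have hη' := uIcc_subset_uIcc right_mem_uIcc hξ hη
        simp only [hflow η hη', stripRetract_of_mem (hmem η hη')]
      have cc : Continuous fun ξ => Real.exp (∫ η in x..ξ,
          b j j (stripRetract 2 (η, (G j).flow (η, x, t))) /
            a j (stripRetract 2 (η, (G j).flow (η, x, t)))) := by
        refine Real.continuous_exp.comp ?_
        apply continuous_integral_of_continuous _ continuous_const continuous_id
        exact (continuous_comp_stripRetract cβ).comp
          (by fun_prop : Continuous fun p : ℝ × ℝ => (p.2, (G j).flow (p.2, x, t)))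
      have cflow : Continuous fun ξ => (ξ, (G j).flow (ξ, x, t)) := by fun_prop
      have hw0 : 0 < w (inflowSide m j) := by
        rw [hflow _ left_mem_uIcc]
        have : (2 : ℝ) ≤ _ := (hmem _ left_mem_uIcc).2
        exact two_pos.trans_le this
      rw [hrep, hc _ left_mem_uIcc, boundaryData, if_pos hw0, hflow _ left_mem_uIcc,
        sub_add_eq_add_sub, add_sub_assoc]
      congr 1
      rw [← intervalIntegral.integral_congr (f := fun ξ => Real.exp (∫ η in x..ξ,
          b j j (stripRetract 2 (η, (G j).flow (η, x, t))) /
            a j (stripRetract 2 (η, (G j).flow (η, x, t)))) *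
              (f j (stripRetract 2 (ξ, (G j).flow (ξ, x, t))) /
                a j (stripRetract 2 (ξ, (G j).flow (ξ, x, t)))))
          (g := fun ξ => dFun a b j w x ξ * f j (ξ, w ξ)) fun ξ hξ => ?_,
        ← intervalIntegral.integral_congr (f := fun ξ => Real.exp (∫ η in x..ξ,
          b j j (stripRetract 2 (η, (G j).flow (η, x, t))) /
            a j (stripRetract 2 (η, (G j).flow (η, x, t)))) *
              ∑ k ∈ Finset.univ.filter (fun k => k ≠ j),
                b j k (stripRetract 2 (ξ, (G j).flow (ξ, x, t))) /
                  a j (stripRetract 2 (ξ, (G j).flow (ξ, x, t))) *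
                    u k (stripRetract 2 (ξ, (G j).flow (ξ, x, t))))
          (g := fun ξ => dFun a b j w x ξ * ∑ k ∈ Finset.univ.filter (fun k => k ≠ j),
            b j k (ξ, w ξ) * u k (ξ, w ξ)) fun ξ hξ => ?_,
        ← intervalIntegral.integral_sub]
      · simp only [Pi.sub_apply, mul_sub]
      · exact (cc.mul ((continuous_comp_stripRetract cfa).comp cflow)).intervalIntegrable _ _
      · exact (cc.mul ((continuous_comp_stripRetract cS).comp cflow)).intervalIntegrable _ _
      · simp only [dFun, hc ξ hξ, hflow ξ hξ, stripRetract_of_mem (hmem ξ hξ), Finset.mul_sum]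
        exact Finset.sum_congr rfl fun k _ => by ring
      · simp only [dFun, hc ξ hξ, hflow ξ hξ, stripRetract_of_mem (hmem ξ hξ)]
        ring
  · obtain ⟨y, w, hw, hrep⟩ := hu.2 j (inflowSide m j) (inflowSide_mem m j) t (by
      exact mem_Ici.2 (by linarith))
    obtain ⟨rfl, hflow⟩ := hw.eq_flow (hg j) (ha j) (inflowSide_mem m j) ((hT j).trans_lt ht)
    rw [hrep]
    have ht0 : 0 < t := by linarith
    simp [cFun, boundaryData, hw.initial, ht0]

end HypSmoothing

end

theorem theorem2p1 (n m : ℕ) (hmn : m ≤ n)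
    (a : Fin n → ℝ × ℝ → ℝ) (b : Fin n → Fin n → ℝ × ℝ → ℝ) (f : Fin n → ℝ × ℝ → ℝ)
    (h φ : Fin n → ℝ → ℝ)
    (ha : ∀ j, ContDiffOn ℝ ∞ (a j) (HypSmoothing.closedStrip 0))
    (hb : ∀ j k, ContDiffOn ℝ ∞ (b j k) (HypSmoothing.closedStrip 0))
    (hf : ∀ j, ContDiffOn ℝ ∞ (f j) (HypSmoothing.closedStrip 0))
    (hh : ∀ j, ContDiffOn ℝ ∞ (h j) (Set.Ici 0))
    (hφ : ∀ j, ContinuousOn (φ j) (Set.Icc 0 1))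
    (hpos : ∀ j : Fin n, (j : ℕ) < m → ∀ z ∈ HypSmoothing.closedStrip 0, 0 < a j z)
    (hneg : ∀ j : Fin n, m ≤ (j : ℕ) → ∀ z ∈ HypSmoothing.closedStrip 0, a j z < 0)
    (hinf : ∀ j, ∃ c : ℝ, 0 < c ∧ ∀ z ∈ HypSmoothing.closedStrip 0, c ≤ |a j z|)
    (hlevy : HypSmoothing.LevyCondition a b)
    (u : Fin n → ℝ × ℝ → ℝ)
    (hu : HypSmoothing.IsContinuousSolution m a b f h φ u) :
    HypSmoothing.IsSmoothing u := by
  open HypSmoothing in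
  choose c hc hac using hinf
  choose G hg hM hgs hdgs using fun j => exists_speedField (ha j) (hc j) (hac j)
  set M := ∑ j, (G j).M with hMdef
  have hGM : ∀ j, (G j).M ≤ M := fun j =>
    Finset.single_le_sum (f := fun j => (G j).M) (fun i _ => (G i).M_nonneg) (Finset.mem_univ j)
  have hM0 : 0 ≤ M := Finset.sum_nonneg fun i _ => (G i).M_nonneg
  have hsub : closedStrip (2 + M) ⊆ closedStrip 0 := closedStrip_anti (by linarith)
  have hsub2 : closedStrip (2 + M) ⊆ closedStrip 2 := closedStrip_anti (by linarith)
  have ha0 : ∀ j, ∀ z ∈ closedStrip 0, a j z ≠ 0 := fun j z hz =>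
    abs_pos.1 ((hc j).trans_le (hac j z hz))
  have hsol := hu.isCharSolution (T := 2 + M) hg hM (by linarith) (fun j => by linarith [hGM j])
    (fun j k => (hb j k).continuousOn) (fun j => (hf j).continuousOn)
  have hL : IsLevy G (2 + M) (fun j k z => b j k z / a j z) := by
    intro j k hjk
    obtain ⟨p, hp, hbp, -⟩ := hlevy j k hjk
    refine ⟨fun z => p z * a k z, (hp.mul ((ha k).of_le (by simp))).mono hsub, fun z hz => ?_⟩
    have h1 := ha0 j z (hsub hz)
    have h2 := ha0 k z (hsub hz)
    simp only [hbp z (hsub hz), hg j z (hsub2 hz), hg k z (hsub2 hz)]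
    field_simp
  intro k
  obtain ⟨T, hT, hreg⟩ := hsol.exists_contDiffOn hGM (inflowSide_mem m) hgs hdgs k (by linarith)
    (fun j k => ((hb j k).div (ha j) (ha0 j)).mono hsub)
    (fun j => (((hf j).div (ha j) (ha0 j)).mono hsub).of_le (by exact_mod_cast le_top))
    (fun j => (hh j).mono (Ici_subset_Ici.2 (by linarith))) hL
  exact ⟨T, by linarith, hreg⟩
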